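/- **Setting.** All graphs are finite, simple, loopless and undirected. A *linear arrangement* of a graph $G=(V,E)$ with $n=|V|$ is a bijection $\ell\colon [n]\to V$; its $i$-th cut is $E_i=\{\{\ell(j),\ell(k)\}\in E : j\le i<k\}$, and its *cutwidth* is $\mathrm{ctw}(\ell)=\max_{i\in[n]}|E_i|$ (and $0$ if $n=0$). A *connected vertex cover* of $G$ is a set $S\subseteq V$ that meets every edge of $G$ and for which $G[S]$ is connected (in particular, $S\neq\emptyset$). The problem *Connected Vertex Cover* has as input a graph $G$ and a number $k\in\mathbb N$, and asks whether $G$ has a connected vertex cover of size $k$. Both common readings are considered: "of size exactly $k$" and "of size at most $k$". Algorithms are programs for a randomized random access machine with fair coin flips, whose running time is measured by logarithmic cost (every operation is charged one unit plus the bit lengths of the numbers involved). The input consists of $n$, $k$, the adjacency matrix of $G$ (with $V=\{0,\dots,n-1\}$) and the list of the values of $\ell$. **Theorem.** For each of the two readings of Connected Vertex Cover there exist a randomized algorithm and constants $C,d\in\mathbb N$ such that, given any graph $G$ on $n$ vertices, any linear arrangement $\ell$ of $G$ and any $k\in\mathbb N$: 1. whatever the outcomes of the coin flips, the algorithm halts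 within time $C\cdot 2^{\mathrm{ctw}(\ell)}\cdot(n+|k|+1)^d$, where $|k|$ is the bit length of $k$; that is, it runs in time $\mathcal O^*(2^{\mathrm{ctw}(\ell)})$; 2. if $(G,k)$ is a no-instance, the algorithm never answers "yes" (there are no false positives); 3. if $(G,k)$ is a yes-instance, the algorithm answers "yes" except with probability at most $1/2$ (false negatives). -/

import Mathlib

open MeasureTheory
open scoped ENNReal

namespace CutwidthCVC

/-! ### Graphs, linear arrangements, connected vertex covers -/

section Graphs

variable {V : Type*}

/-- The cut at position `i` of the linear arrangement `ℓ`: the edges with one end at a position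
`≤ i` and the other end at a position `> i`. -/
def cut (G : SimpleGraph V) {n : ℕ} (ℓ : Fin n ≃ V) (i : Fin n) : Set (Sym2 V) :=
  {e | e ∈ G.edgeSet ∧ ∃ j k : Fin n, j ≤ i ∧ i < k ∧ e = s(ℓ j, ℓ k)}

/-- The cutwidth of a linear arrangement: the maximum size of a cut (`0` for the empty graph). -/
noncomputable def cutwidth (G : SimpleGraph V) {n : ℕ} (ℓ : Fin n ≃ V) : ℕ :=
  Finset.univ.sup fun i => (cut G ℓ i).ncard

/-- `S` is a vertex cover of `G` and `G[S]` is connected (in particular nonempty). -/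
def IsConnectedVertexCover (G : SimpleGraph V) (S : Finset V) : Prop :=
  G.IsVertexCover (S : Set V) ∧ (G.induce (S : Set V)).Connected

/-- A connected vertex cover of size exactly `k` exists. -/
def HasCVCOfSize (G : SimpleGraph V) (k : ℕ) : Prop :=
  ∃ S : Finset V, IsConnectedVertexCover G S ∧ S.card = k

/-- A connected vertex cover of size at most `k` exists. -/
def HasCVCOfSizeAtMost (G : SimpleGraph V) (k : ℕ) : Prop :=
  ∃ S : Finset V, IsConnectedVertexCover G S ∧ S.card ≤ k

end Graphs

/-! ### Randomized random access machines with logarithmic cost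

The memory consists of variables and of arrays, indexed by the natural numbers and holding natural
numbers; a program mentions finitely many of them. Every operation is charged one unit plus the
bit lengths of the numbers that occur in it (operands, results and array indices). -/

/-- The arithmetical operations. -/
inductive Op
  | add | sub | mul | div | mod | lt | eq

/-- Truncated subtraction, floor division, and comparisons with value `0` or `1`. -/
def Op.eval : Op → ℕ → ℕ → ℕ
  | .add, a, b => a + b
  | .sub, a, b => a - b
  | .mul, a, b => a * b
  | .div, a, b => a / b
  | .mod, a, b => a % b
  | .lt, a, b => if a < b then 1 else 0
  | .eq, a, b => if a = b then 1 else 0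

/-- Expressions: literals, variables, array cells `a[e]`, operations. -/
inductive Expr
  | lit (c : ℕ)
  | var (x : ℕ)
  | get (a : ℕ) (e : Expr)
  | op (o : Op) (e₁ e₂ : Expr)

/-- Programs. The command `flip x` stores a fair random bit in the variable `x`; conditions are
true when their value is not `0`. -/
inductive Prog
  | skip
  | assign (x : ℕ) (e : Expr)
  | store (a : ℕ) (e₁ e₂ : Expr)
  | flip (x : ℕ)
  | seq (p q : Prog)
  | ite (e : Expr) (p q : Prog)
  | while (e : Expr) (p : Prog)

/-- A configuration: values of the variables, contents of the arrays, and the number of random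
bits that have been used so far. -/
structure State where
  var : ℕ → ℕ
  arr : ℕ → ℕ → ℕ
  pos : ℕ

/-- The value of an expression. -/
def Expr.eval (s : State) : Expr → ℕ
  | .lit c => c
  | .var x => s.var x
  | .get a e => s.arr a (e.eval s)
  | .op o e₁ e₂ => o.eval (e₁.eval s) (e₂.eval s)

/-- The logarithmic cost of evaluating an expression: every subexpression costs one plus the bit
length of its value. -/
def Expr.cost (s : State) : Expr → ℕ
  | .lit c => 1 + c.size
  | .var x => 1 + (s.var x).size
  | .get a e => e.cost s + 1 + (s.arr a (e.eval s)).size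
  | .op o e₁ e₂ => e₁.cost s + e₂.cost s + 1 + (o.eval (e₁.eval s) (e₂.eval s)).size

/-- `Exec r p s s' t`: with the sequence `r` of random bits, the program `p` started in `s` halts
in `s'` after time `t`. -/
inductive Exec (r : ℕ → Bool) : Prog → State → State → ℕ → Prop
  | skip (s : State) : Exec r .skip s s 1
  | assign (x : ℕ) (e : Expr) (s : State) :
      Exec r (.assign x e) s { s with var := Function.update s.var x (e.eval s) } (e.cost s + 1)
  | store (a : ℕ) (e₁ e₂ : Expr) (s : State) :
      Exec r (.store a e₁ e₂) s
        { s with arr := Function.update s.arr a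
                          (Function.update (s.arr a) (e₁.eval s) (e₂.eval s)) }
        (e₁.cost s + e₂.cost s + 1)
  | flip (x : ℕ) (s : State) :
      Exec r (.flip x) s
        { s with var := Function.update s.var x (if r s.pos then 1 else 0), pos := s.pos + 1 } 1
  | seq {p q : Prog} {s s' s'' : State} {t t' : ℕ} :
      Exec r p s s' t → Exec r q s' s'' t' → Exec r (.seq p q) s s'' (t + t')
  | ite_true {e : Expr} {p q : Prog} {s s' : State} {t : ℕ} :
      e.eval s ≠ 0 → Exec r p s s' t → Exec r (.ite e p q) s s' (e.cost s + 1 + t)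
  | ite_false {e : Expr} {p q : Prog} {s s' : State} {t : ℕ} :
      e.eval s = 0 → Exec r q s s' t → Exec r (.ite e p q) s s' (e.cost s + 1 + t)
  | while_true {e : Expr} {p : Prog} {s s' s'' : State} {t t' : ℕ} :
      e.eval s ≠ 0 → Exec r p s s' t → Exec r (.while e p) s' s'' t' →
        Exec r (.while e p) s s'' (e.cost s + 1 + t + t')
  | while_false {e : Expr} {p : Prog} {s : State} :
      e.eval s = 0 → Exec r (.while e p) s s (e.cost s + 1)

/-- The final configuration and the running time are determined by the random bits. -/
theorem Exec.deterministic {r : ℕ → Bool} {p : Prog} {s s₁ s₂ : State} {t₁ t₂ : ℕ}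
    (h₁ : Exec r p s s₁ t₁) (h₂ : Exec r p s s₂ t₂) : s₁ = s₂ ∧ t₁ = t₂ := by
  induction h₁ generalizing s₂ t₂ with
  | skip | assign | store | flip => cases h₂; exact ⟨rfl, rfl⟩
  | seq _ _ ih ih' =>
    cases h₂ with
    | seq a b =>
      obtain ⟨rfl, rfl⟩ := ih a
      obtain ⟨rfl, rfl⟩ := ih' b
      exact ⟨rfl, rfl⟩
  | ite_true h _ ih =>
    cases h₂ with
    | ite_true _ a => obtain ⟨rfl, rfl⟩ := ih a; exact ⟨rfl, rfl⟩
    | ite_false h' _ => exact absurd h' h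
  | ite_false h _ ih =>
    cases h₂ with
    | ite_true h' _ => exact absurd h h'
    | ite_false _ a => obtain ⟨rfl, rfl⟩ := ih a; exact ⟨rfl, rfl⟩
  | while_true h _ _ ih ih' =>
    cases h₂ with
    | while_true _ a b =>
      obtain ⟨rfl, rfl⟩ := ih a
      obtain ⟨rfl, rfl⟩ := ih' b
      exact ⟨rfl, rfl⟩
    | while_false h' => exact absurd h' h
  | while_false h =>
    cases h₂ with
    | while_true h' _ _ => exact absurd h h'
    | while_false _ => exact ⟨rfl, rfl⟩

/-- The distribution of an infinite sequence of independent fair random bits. -/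
noncomputable def coins : Measure (ℕ → Bool) :=
  Measure.infinitePi fun _ => (PMF.uniformOfFintype Bool).toMeasure

/-! ### Algorithms for graph problems with a given linear arrangement -/

open Classical in
/-- The input: the variables `0` and `1` hold the number `n` of vertices and the number `k`, the
array `0` lists the linear arrangement, and the array `1` is the adjacency matrix, row by row.
Everything else is `0`. -/
noncomputable def input {n : ℕ} (G : SimpleGraph (Fin n)) (ℓ : Fin n ≃ Fin n) (k : ℕ) : State where
  var := fun x => if x = 0 then n else if x = 1 then k else 0
  arr := fun a m =>
    if a = 0 then (if h : m < n then (ℓ ⟨m, h⟩ : ℕ) else 0)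
    else if a = 1 then
      (if ∃ u v : Fin n, G.Adj u v ∧ m = (u : ℕ) * n + (v : ℕ) then 1 else 0)
    else 0
  pos := 0

/-- With the random bits `r`, the program halts on the given input within time `T`. -/
def HaltsWithin (P : Prog) {n : ℕ} (G : SimpleGraph (Fin n)) (ℓ : Fin n ≃ Fin n) (k : ℕ)
    (r : ℕ → Bool) (T : ℕ) : Prop :=
  ∃ (s : State) (t : ℕ), Exec r P (input G ℓ k) s t ∧ t ≤ T

/-- With the random bits `r`, the program halts on the given input and answers "yes", that is,
the variable `0` has the final value `1`. -/
def Accepts (P : Prog) {n : ℕ} (G : SimpleGraph (Fin n)) (ℓ : Fin n ≃ Fin n) (k : ℕ)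
    (r : ℕ → Bool) : Prop :=
  ∃ (s : State) (t : ℕ), Exec r P (input G ℓ k) s t ∧ s.var 0 = 1

/-- The program solves the problem `Q` on graphs given with a linear arrangement: it never gives
a false positive, and gives a false negative with probability at most `1/2`. -/
def SolvesOneSided (P : Prog) (Q : ∀ {n : ℕ}, SimpleGraph (Fin n) → ℕ → Prop) : Prop :=
  ∀ (n : ℕ) (G : SimpleGraph (Fin n)) (ℓ : Fin n ≃ Fin n) (k : ℕ),
    (¬ Q G k → ∀ r : ℕ → Bool, ¬ Accepts P G ℓ k r) ∧
    (Q G k → coins {r | ¬ Accepts P G ℓ k r} ≤ 1 / 2)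

/-- For all random bits, the running time is at most `2 ^ ctw` times a polynomial in the input
size, where `ctw` is the cutwidth of the given linear arrangement and the input size is measured by
the number of vertices plus the bit length of `k`. -/
def RunsInTimeTwoPowCutwidth (P : Prog) : Prop :=
  ∃ C d : ℕ, ∀ (n : ℕ) (G : SimpleGraph (Fin n)) (ℓ : Fin n ≃ Fin n) (k : ℕ) (r : ℕ → Bool),
    HaltsWithin P G ℓ k r (C * 2 ^ cutwidth G ℓ * (n + k.size + 1) ^ d)

end CutwidthCVC

/-!
The algorithm is *Cut & Count* with a table indexed by colourings of the edges of a cut.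

Fix a root vertex and give every vertex one of three states: outside of the cover (`0`), or in the
cover and left (`1`) or right (`2`), the root being left. Call an assignment of states consistent if
every edge is covered and no edge joins left to right. Exchanging left and right in all components
of the cover but that of the root is an involution, so that modulo two, only the assignments with
connected cover count, and each connected vertex cover that contains the root counts once
(`card_consistent`, `total_eq_sum`).

The compatibility of the states of the two ends of an edge is a `3 × 3` matrix of rank two over the
field with two elements: it equals `A * Aᵀ`, where `A` is the `3 × 2` matrix `colourOk`. Hence the
number of consistent assignments has the parity of the number of assignments of states to the
vertices and of two colours to the edges in which every edge is compatible with both of its ends.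
Summing over the vertices in the order of the linear arrangement, one has to remember only the
colours of the edges in the current cut, which gives tables with `2 ^ ctw` entries. A vertex is
processed together with its state; its edges to the left are closed and its edges to the right are
opened one by one (`tableU_zero`, `tableU_remove`, `tableU_add`, `tableT_succ`, `length_wires_le`).

So that the covers do not cancel modulo two, the vertices carry random weights of logarithmic bit
length, and the sum is a polynomial that records size and total weight in its exponent. By the
Schwartz–Zippel lemma over the polynomial ring, with powers of the indeterminate as sample points,
the part that belongs to a given size vanishes modulo two with probability at most one half
(`coins_weightGen_eq_zero`). An odd coefficient always comes from an actual cover. The program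
works with the values of these polynomials at a large power of two, `base`, so that the coefficients
can be read off as digits (`cast_digit`); nothing is reduced modulo two before that.

The program is verified with a small Hoare logic (`Tri`) that bounds the number of steps and the bit
lengths in memory, and hence the logarithmic cost. The root runs over all vertices, and an input is
accepted if for some root some odd coefficient has an admissible size (`Detected`).
-/

open MeasureTheory
open scoped ENNReal

namespace CutwidthCVC

/-! ### A program logic for running times -/

/-- A constant that bounds the cost of evaluating an expression in units of one plus the largest
bit length in memory. -/
def Expr.weight : Expr → ℕ
  | .lit c => c.size + 1
  | .var _ => 1
  | .get _ e => e.weight + 1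
  | .op _ e₁ e₂ => 2 * e₁.weight + 2 * e₂.weight + 2

/-- A constant that bounds the cost of every single step of a program, in units of one plus the
largest bit length in memory. -/
def Prog.weight : Prog → ℕ
  | .skip => 1
  | .assign _ e => e.weight + 1
  | .store _ e₁ e₂ => e₁.weight + e₂.weight + 1
  | .flip _ => 1
  | .seq p q => p.weight + q.weight
  | .ite e p q => e.weight + 1 + p.weight + q.weight
  | .while e p => e.weight + 1 + p.weight

/-- All numbers in memory have at most `L` bits. -/
def State.Bounded (L : ℕ) (s : State) : Prop :=
  (∀ x, s.var x < 2 ^ L) ∧ ∀ a i, s.arr a i < 2 ^ L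

theorem Op.size_eval_le (o : Op) (a b : ℕ) : (o.eval a b).size ≤ a.size + b.size + 1 := by
  have ha := Nat.lt_size_self a
  have hb := Nat.lt_size_self b
  have h1 : 2 ^ a.size ≤ 2 ^ (a.size + b.size) := Nat.pow_le_pow_right (by norm_num) (by omega)
  have h2 : 2 ^ b.size ≤ 2 ^ (a.size + b.size) := Nat.pow_le_pow_right (by norm_num) (by omega)
  have h3 : 1 ≤ 2 ^ (a.size + b.size) := Nat.one_le_two_pow
  have h4 : 2 ^ (a.size + b.size + 1) = 2 * 2 ^ (a.size + b.size) := pow_succ' _ _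
  rw [Nat.size_le]
  cases o with
  | add => simp only [Op.eval]; omega
  | sub => simp only [Op.eval]; omega
  | mul =>
    simp only [Op.eval]
    have : a * b < 2 ^ a.size * 2 ^ b.size := Nat.mul_lt_mul'' ha hb
    rw [← pow_add] at this
    omega
  | div =>
    simp only [Op.eval]
    have := Nat.div_le_self a b
    omega
  | mod =>
    simp only [Op.eval]
    have := Nat.mod_le a b
    omega
  | lt => simp only [Op.eval]; split_ifs <;> omega
  | eq => simp only [Op.eval]; split_ifs <;> omega

theorem Expr.size_eval_lt_cost (s : State) (e : Expr) : (e.eval s).size < e.cost s := by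
  cases e <;> simp only [Expr.eval, Expr.cost] <;> omega

theorem Expr.cost_le {L : ℕ} {s : State} (hs : s.Bounded L) (e : Expr) :
    e.cost s ≤ e.weight * (L + 1) := by
  induction e with
  | lit c =>
    simp only [Expr.cost, Expr.weight]
    nlinarith
  | var x =>
    simp only [Expr.cost, Expr.weight]
    have := Nat.size_le.2 (hs.1 x)
    omega
  | get a e ih =>
    simp only [Expr.cost, Expr.weight]
    have := Nat.size_le.2 (hs.2 a (e.eval s))
    rw [add_mul]
    omega
  | op o e₁ e₂ ih₁ ih₂ =>
    simp only [Expr.cost, Expr.weight]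
    have := o.size_eval_le (e₁.eval s) (e₂.eval s)
    have h1 := e₁.size_eval_lt_cost s
    have h2 := e₂.size_eval_lt_cost s
    simp only [add_mul, mul_assoc]
    omega

/-- The state after assigning `v` to the variable `x`. -/
def State.setVar (s : State) (x v : ℕ) : State := { s with var := Function.update s.var x v }

/-- The state after storing `v` in the cell `i` of the array `a`. -/
def State.setArr (s : State) (a i v : ℕ) : State :=
  { s with arr := Function.update s.arr a (Function.update (s.arr a) i v) }

/-- The state after flipping a coin with outcome `b` into the variable `x`. -/
def State.setFlip (s : State) (x : ℕ) (b : Bool) : State :=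
  { s with var := Function.update s.var x (if b then 1 else 0), pos := s.pos + 1 }

section setters
variable (s : State) (x v y a i b j : ℕ) (c : Bool)

@[simp] theorem State.setVar_var : (s.setVar x v).var y = if y = x then v else s.var y := by
  simp [State.setVar, Function.update_apply]
@[simp] theorem State.setVar_arr : (s.setVar x v).arr = s.arr := rfl
@[simp] theorem State.setVar_pos : (s.setVar x v).pos = s.pos := rfl
@[simp] theorem State.setArr_arr :
    (s.setArr a i v).arr b j = if b = a ∧ j = i then v else s.arr b j := by
  by_cases h : b = a
  · subst h; simp [State.setArr, Function.update_apply]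
  · simp [State.setArr, h]
@[simp] theorem State.setArr_pos : (s.setArr a i v).pos = s.pos := rfl
@[simp] theorem State.setFlip_var :
    (s.setFlip x c).var y = if y = x then (if c then 1 else 0) else s.var y := by
  simp [State.setFlip, Function.update_apply]
@[simp] theorem State.setFlip_pos : (s.setFlip x c).pos = s.pos + 1 := rfl

end setters

theorem State.Bounded.setVar {L : ℕ} {s : State} (hs : s.Bounded L) {x v : ℕ} (hv : v < 2 ^ L) :
    (s.setVar x v).Bounded L :=
  ⟨fun y => by simp only [State.setVar_var]; split_ifs; exacts [hv, hs.1 y], hs.2⟩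

/-- Whether the variable `x` is a target of some command of the program. -/
def Prog.writesVar (x : ℕ) : Prog → Bool
  | .skip => false
  | .assign y _ => x == y
  | .store _ _ _ => false
  | .flip y => x == y
  | .seq p q => p.writesVar x || q.writesVar x
  | .ite _ p q => p.writesVar x || q.writesVar x
  | .while _ p => p.writesVar x

/-- Whether the array `a` is a target of some command of the program. -/
def Prog.writesArr (a : ℕ) : Prog → Bool
  | .skip => false
  | .assign _ _ => false
  | .store b _ _ => a == b
  | .flip _ => false
  | .seq p q => p.writesArr a || q.writesArr a
  | .ite _ p q => p.writesArr a || q.writesArr a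
  | .while _ p => p.writesArr a

/-- Whether the program contains a coin flip. -/
def Prog.flips : Prog → Bool
  | .skip => false
  | .assign _ _ => false
  | .store _ _ _ => false
  | .flip _ => true
  | .seq p q => p.flips || q.flips
  | .ite _ p q => p.flips || q.flips
  | .while _ p => p.flips

/-- The two states agree on everything that the program does not mention as a target. -/
structure Frame (p : Prog) (s s' : State) : Prop where
  var : ∀ x, p.writesVar x = false → s'.var x = s.var x
  arr : ∀ a, p.writesArr a = false → s'.arr a = s.arr a
  pos : p.flips = false → s'.pos = s.pos

theorem Frame.trans {p : Prog} {s s' s'' : State} (h : Frame p s s') (h' : Frame p s' s'') :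
    Frame p s s'' :=
  ⟨fun x hx => (h'.var x hx).trans (h.var x hx), fun a ha => (h'.arr a ha).trans (h.arr a ha),
    fun hp => (h'.pos hp).trans (h.pos hp)⟩

theorem Frame.mono {p q : Prog} {s s' : State} (h : Frame p s s')
    (hv : ∀ x, q.writesVar x = false → p.writesVar x = false)
    (ha : ∀ a, q.writesArr a = false → p.writesArr a = false)
    (hf : q.flips = false → p.flips = false) : Frame q s s' :=
  ⟨fun x hx => h.var x (hv x hx), fun a hx => h.arr a (ha a hx), fun hp => h.pos (hf hp)⟩

theorem Exec.frame {r : ℕ → Bool} {p : Prog} {s s' : State} {t : ℕ} (h : Exec r p s s' t) :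
    Frame p s s' := by
  induction h with
  | skip s => exact ⟨fun _ _ => rfl, fun _ _ => rfl, fun _ => rfl⟩
  | assign x e s =>
    refine ⟨fun y hy => ?_, fun _ _ => rfl, fun _ => rfl⟩
    simp only [Prog.writesVar, beq_eq_false_iff_ne] at hy
    simp [hy]
  | store a e₁ e₂ s =>
    refine ⟨fun _ _ => rfl, fun b hb => ?_, fun _ => rfl⟩
    simp only [Prog.writesArr, beq_eq_false_iff_ne] at hb
    simp [hb]
  | flip x s =>
    refine ⟨fun y hy => ?_, fun _ _ => rfl, fun hf => by simp [Prog.flips] at hf⟩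
    simp only [Prog.writesVar, beq_eq_false_iff_ne] at hy
    simp [hy]
  | seq _ _ ih ih' =>
    refine (ih.mono ?_ ?_ ?_).trans (ih'.mono ?_ ?_ ?_) <;>
      simp +contextual [Prog.writesVar, Prog.writesArr, Prog.flips]
  | ite_true _ _ ih =>
    refine ih.mono ?_ ?_ ?_ <;> simp +contextual [Prog.writesVar, Prog.writesArr, Prog.flips]
  | ite_false _ _ ih =>
    refine ih.mono ?_ ?_ ?_ <;> simp +contextual [Prog.writesVar, Prog.writesArr, Prog.flips]
  | while_true _ _ _ ih ih' =>
    refine (ih.mono ?_ ?_ ?_).trans ih' <;> simp [Prog.writesVar, Prog.writesArr, Prog.flips]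
  | while_false _ => exact ⟨fun _ _ => rfl, fun _ _ => rfl, fun _ => rfl⟩

/-- If the numbers in memory have at most `L` bits, then the program halts after at most `T` steps,
each of which costs at most a constant times `L + 1`; the final numbers have at most `L` bits and
the final state satisfies `Q`. -/
def Tri (r : ℕ → Bool) (L : ℕ) (p : Prog) (s : State) (T : ℕ) (Q : State → Prop) : Prop :=
  s.Bounded L → ∃ s' t, Exec r p s s' t ∧ t ≤ T * (p.weight * (L + 1)) ∧ s'.Bounded L ∧ Q s'

section Rules

variable {r : ℕ → Bool} {L : ℕ} {p q : Prog} {s : State} {T T' : ℕ} {Q Q' : State → Prop}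

theorem Tri.conseq (h : Tri r L p s T Q) (hQ : ∀ s', Frame p s s' → Q s' → Q' s')
    (hT : T ≤ T') : Tri r L p s T' Q' := fun hs => by
  obtain ⟨s', t, h1, h2, h3, h4⟩ := h hs
  exact ⟨s', t, h1, h2.trans (Nat.mul_le_mul_right _ hT), h3, hQ s' h1.frame h4⟩

theorem Tri.skip (h : Q s) : Tri r L .skip s 1 Q := fun hs =>
  ⟨s, 1, .skip s, by simp only [Prog.weight]; omega, hs, h⟩

theorem Tri.assign {x v : ℕ} {e : Expr} (he : e.eval s = v) (hv : v < 2 ^ L)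
    (h : Q (s.setVar x v)) : Tri r L (.assign x e) s 1 Q := fun hs => by
  subst he
  refine ⟨_, _, .assign x e s, ?_, hs.setVar hv, h⟩
  have := e.cost_le hs
  simp only [Prog.weight, add_mul]
  omega

theorem Tri.store {a i v : ℕ} {e₁ e₂ : Expr} (he₁ : e₁.eval s = i) (he₂ : e₂.eval s = v)
    (hv : v < 2 ^ L) (h : Q (s.setArr a i v)) : Tri r L (.store a e₁ e₂) s 1 Q := fun hs => by
  subst he₁ he₂
  refine ⟨_, _, .store a e₁ e₂ s, ?_, ⟨hs.1, fun b j => ?_⟩, h⟩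
  · have := e₁.cost_le hs
    have := e₂.cost_le hs
    simp only [Prog.weight, add_mul]
    omega
  · change (s.setArr a _ _).arr b j < _
    rw [State.setArr_arr]
    split_ifs
    exacts [hv, hs.2 b j]

theorem Tri.flip {x : ℕ} (hL : 0 < L) (h : Q (s.setFlip x (r s.pos))) :
    Tri r L (.flip x) s 1 Q := fun hs => by
  refine ⟨_, _, .flip x s, by simp only [Prog.weight]; omega, ⟨fun y => ?_, hs.2⟩, h⟩
  change (s.setFlip x _).var y < _
  rw [State.setFlip_var]
  have : 1 < 2 ^ L := Nat.one_lt_two_pow hL.ne'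
  split_ifs
  exacts [this, by omega, hs.1 y]

theorem Tri.seq (hp : Tri r L p s T Q') (hq : ∀ s', Frame p s s' → Q' s' → Tri r L q s' T' Q) :
    Tri r L (.seq p q) s (T + T') Q := fun hs => by
  obtain ⟨s', t, h1, h2, h3, h4⟩ := hp hs
  obtain ⟨s'', t', h1', h2', h3', h4'⟩ := hq s' h1.frame h4 h3
  refine ⟨s'', t + t', .seq h1 h1', ?_, h3', h4'⟩
  refine (Nat.add_le_add h2 h2').trans ?_
  simp only [Prog.weight]
  have h5 : T * (p.weight * (L + 1)) ≤ T * ((p.weight + q.weight) * (L + 1)) := by gcongr; omega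
  have h6 : T' * (q.weight * (L + 1)) ≤ T' * ((p.weight + q.weight) * (L + 1)) := by gcongr; omega
  rw [add_mul T T']
  omega

theorem Tri.ite {e : Expr} (hp : e.eval s ≠ 0 → Tri r L p s T Q)
    (hq : e.eval s = 0 → Tri r L q s T Q) : Tri r L (.ite e p q) s (T + 1) Q := fun hs => by
  have hc := e.cost_le hs
  have h5 : T * (p.weight * (L + 1)) ≤ T * ((e.weight + 1 + p.weight + q.weight) * (L + 1)) := by
    gcongr; omega
  have h6 : T * (q.weight * (L + 1)) ≤ T * ((e.weight + 1 + p.weight + q.weight) * (L + 1)) := by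
    gcongr; omega
  have h7 : (e.weight + 1) * (L + 1) ≤ (e.weight + 1 + p.weight + q.weight) * (L + 1) :=
    Nat.mul_le_mul_right _ (by omega)
  rw [add_mul] at h7
  by_cases he : e.eval s = 0
  · obtain ⟨s', t, h1, h2, h3, h4⟩ := hq he hs
    refine ⟨s', _, .ite_false he h1, ?_, h3, h4⟩
    simp only [Prog.weight, add_mul T 1]
    omega
  · obtain ⟨s', t, h1, h2, h3, h4⟩ := hp he hs
    refine ⟨s', _, .ite_true he h1, ?_, h3, h4⟩
    simp only [Prog.weight, add_mul T 1]
    omega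

/-- The loop `for x = 0, …, e - 1 do p`. -/
def forLoop (x : ℕ) (e : Expr) (p : Prog) : Prog :=
  .seq (.assign x (.lit 0))
    (.while (.op .lt (.var x) e) (.seq p (.assign x (.op .add (.var x) (.lit 1)))))

theorem Frame.setVar {x v : ℕ} (hx : p.writesVar x = true) : Frame p s (s.setVar x v) :=
  ⟨fun y hy => by
    have : y ≠ x := by rintro rfl; simp [hx] at hy
    simp [this], fun _ _ => rfl, fun _ => rfl⟩

/-- The loop rule: the invariant `I i` holds before the `i`-th iteration. The body may use that
the variables, arrays and coins that the loop does not touch are as at the beginning. -/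
theorem Tri.forLoop {x m : ℕ} {e : Expr} (I : ℕ → State → Prop) (hx : p.writesVar x = false)
    (hm : m < 2 ^ L)
    (he : ∀ s', Frame (forLoop x e p) s s' → e.eval s' = m)
    (h0 : I 0 (s.setVar x 0))
    (hb : ∀ i < m, ∀ s', I i s' → s'.var x = i → Frame (CutwidthCVC.forLoop x e p) s s' →
      Tri r L p s' T fun s'' => I (i + 1) (s''.setVar x (i + 1))) :
    Tri r L (CutwidthCVC.forLoop x e p) s (m * (T + 2) + 2) (I m) := by
  set w := Prog.while (.op .lt (.var x) e) (.seq p (.assign x (.op .add (.var x) (.lit 1))))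
    with hw
  have hwx : (CutwidthCVC.forLoop x e p).writesVar x = true := by
    simp [CutwidthCVC.forLoop, Prog.writesVar]
  have key : ∀ d i, i + d = m → ∀ s', I i s' → s'.var x = i →
      Frame (CutwidthCVC.forLoop x e p) s s' → Tri r L w s' (d * (T + 2) + 1) (I m) := by
    intro d
    induction d with
    | zero =>
      intro i hi s' hI hxi hf hs
      have hev : (Expr.op .lt (.var x) e).eval s' = 0 := by
        simp only [Expr.eval, Op.eval, he s' hf, hxi]
        rw [if_neg (by omega)]
      refine ⟨s', _, .while_false hev, ?_, hs, by rwa [← hi]⟩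
      have := (Expr.op .lt (.var x) e).cost_le hs
      simp only [hw, Prog.weight, add_mul, one_mul, zero_mul, zero_add] at this ⊢
      omega
    | succ d ih =>
      intro i hi s' hI hxi hf hs
      have hev : (Expr.op .lt (.var x) e).eval s' ≠ 0 := by
        simp only [Expr.eval, Op.eval, he s' hf, hxi]
        rw [if_pos (by omega)]
        exact one_ne_zero
      obtain ⟨s₁, t₁, h1, h2, h3, h4⟩ := hb i (by omega) s' hI hxi hf hs
      have hfr := h1.frame
      have hx1 : s₁.var x = i := by rw [hfr.var x hx, hxi]
      have hassign : Tri r L (.assign x (.op .add (.var x) (.lit 1))) s₁ 1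
          (fun s'' => s'' = s₁.setVar x (i + 1)) :=
        Tri.assign (v := i + 1) (by simp [Expr.eval, Op.eval, hx1]) (by omega) rfl
      obtain ⟨s₂, t₂, k1, k2, k3, k4⟩ := hassign h3
      subst k4
      have hf2 : Frame (CutwidthCVC.forLoop x e p) s (s₁.setVar x (i + 1)) := by
        refine (hf.trans (hfr.mono ?_ ?_ ?_)).trans (Frame.setVar hwx) <;>
        simp +contextual [CutwidthCVC.forLoop, Prog.writesVar, Prog.writesArr, Prog.flips]
      obtain ⟨s₃, t₃, l1, l2, l3, l4⟩ :=
        ih (i + 1) (by omega) _ h4 (by simp) hf2 k3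
      refine ⟨s₃, _, .while_true hev (.seq h1 k1) l1, ?_, l3, l4⟩
      have hc := (Expr.op .lt (.var x) e).cost_le hs
      set W := w.weight * (L + 1) with hW
      set we := (Expr.op .lt (.var x) e).weight
      set wa := (Prog.assign x (.op .add (.var x) (.lit 1))).weight
      have hWe : W = we * (L + 1) + (L + 1) + p.weight * (L + 1) + wa * (L + 1) := by
        have : W = (we + 1 + (p.weight + wa)) * (L + 1) := rfl
        rw [this]; ring
      have e1 : T * (p.weight * (L + 1)) ≤ T * W := Nat.mul_le_mul_left _ (by omega)
      have e3 : ((d + 1) * (T + 2) + 1) * W = (d * (T + 2) + 1) * W + T * W + 2 * W := by ring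
      rw [e3]
      omega
  refine (Tri.seq (Q' := fun s' => s' = s.setVar x 0) (T := 1) (T' := m * (T + 2) + 1)
    (Tri.assign (v := 0) rfl (by positivity) rfl) ?_).conseq (fun _ _ h => h) (by omega)
  rintro s' - rfl
  exact key m 0 (by omega) _ h0 (by simp) (Frame.setVar hwx)

/-- The loop that fills the first `m` cells of the array `a` with the values of `e`, an expression
in the loop variable `2`. -/
def tab (a : ℕ) (m e : Expr) : Prog := forLoop 2 m (.store a (.var 2) e)

theorem Tri.tab {a m : ℕ} {em e : Expr} (f : ℕ → ℕ) (hm : m < 2 ^ L)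
    (hem : ∀ s', Frame (tab a em e) s s' → em.eval s' = m)
    (he : ∀ i < m, ∀ s', Frame (CutwidthCVC.tab a em e) s s' → s'.var 2 = i → e.eval s' = f i)
    (hf : ∀ i < m, f i < 2 ^ L) :
    Tri r L (CutwidthCVC.tab a em e) s (m * 3 + 2)
      fun s' => ∀ i, s'.arr a i = if i < m then f i else s.arr a i := by
  refine (Tri.forLoop (T := 1)
    (fun i s' => ∀ j, s'.arr a j = if j < i then f j else s.arr a j) rfl hm hem (by simp) ?_)
  intro i hi s' hI hxi hfr
  refine Tri.store (i := i) (v := f i) hxi (he i hi s' hfr hxi) (hf i hi) ?_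
  intro j
  simp only [State.setVar_arr, State.setArr_arr, true_and, hI j]
  by_cases hj : j = i
  · simp [hj]
  · have : j < i + 1 ↔ j < i := by omega
    simp [hj, this]

end Rules

/-! ### Sums over vertex states and the tables of the dynamic program -/

/-- The compatibility of a vertex state `x` (`0`: not in the cover, `1`: left, `2`: right) with a
colour `b < 2` of an incident edge: everything is allowed but left with `1` and right with `0`. -/
def colourOk (x b : ℕ) : ℕ := if x + b = 2 then 0 else 1

/-- The number of colours of an edge that are compatible with the states of both ends. It is odd
exactly if the edge is covered and does not join left to right. -/
def compat (x x' : ℕ) : ℕ := colourOk x 0 * colourOk x' 0 + colourOk x 1 * colourOk x' 1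

/-- The sum of `f` over all assignments of states to the vertices `0, …, v - 1`; the other vertices
have state `0`. -/
def stateSum {R : Type*} [CommSemiring R] : ℕ → ((ℕ → ℕ) → R) → R
  | 0, f => f fun _ => 0
  | v + 1, f => stateSum v fun y => ∑ x ∈ Finset.range 3, f (Function.update y v x)

section stateSum
variable {R : Type*} [CommSemiring R]

theorem stateSum_add (v : ℕ) (f g : (ℕ → ℕ) → R) :
    stateSum v (fun y => f y + g y) = stateSum v f + stateSum v g := by
  induction v generalizing f g with
  | zero => rfl
  | succ v ih => simp only [stateSum, Finset.sum_add_distrib, ih]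

theorem stateSum_mul_left (v : ℕ) (c : R) (f : (ℕ → ℕ) → R) :
    stateSum v (fun y => c * f y) = c * stateSum v f := by
  induction v generalizing f with
  | zero => rfl
  | succ v ih => simp only [stateSum, ← Finset.mul_sum, ih]

theorem map_stateSum {R' : Type*} [CommSemiring R'] (φ : R →+* R') (v : ℕ) (f : (ℕ → ℕ) → R) :
    φ (stateSum v f) = stateSum v fun y => φ (f y) := by
  induction v generalizing f with
  | zero => rfl
  | succ v ih => simp only [stateSum, ih, map_sum]

theorem stateSum_le (v b : ℕ) (f : (ℕ → ℕ) → ℕ) (h : ∀ y, f y ≤ b) :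
    stateSum v f ≤ 3 ^ v * b := by
  induction v generalizing f b with
  | zero => simpa [stateSum] using h _
  | succ v ih =>
    refine (ih (3 * b) _ fun y => ?_).trans (by rw [pow_succ]; ring_nf; rfl)
    simpa using Finset.sum_le_card_nsmul (Finset.range 3) _ b fun x _ => h _

/-- The sum over assignments as a sum over functions on `Fin v`. -/
theorem stateSum_eq_sum (v : ℕ) (f : (ℕ → ℕ) → R) :
    stateSum v f = ∑ y : Fin v → Fin 3, f fun i => if h : i < v then (y ⟨i, h⟩ : ℕ) else 0 := by
  induction v generalizing f with
  | zero => simp [stateSum]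
  | succ v ih =>
    rw [stateSum, ih, ← (Fin.snocEquiv fun _ : Fin (v + 1) => Fin 3).sum_comp,
      Fintype.sum_prod_type_right]
    refine Finset.sum_congr rfl fun y _ => ?_
    rw [Finset.sum_range]
    refine Finset.sum_congr rfl fun x _ => congrArg f ?_
    funext i
    rcases lt_trichotomy i v with hi | rfl | hi
    · simp [hi.ne, hi, hi.trans (Nat.lt_succ_self v), Fin.snocEquiv,
        Fin.snoc]
    · simp [Fin.snocEquiv, Fin.snoc]
    · have h1 : ¬ i < v + 1 := by omega
      simp [hi.ne', h1]
      omega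

end stateSum

/-! ### Wires: the edges of the current cut in the order of their pair codes

The ordered pair of the positions `u` and `u'` has the code `u * n + u'`. -/

section wires

variable (n : ℕ) (adj : ℕ → Bool)

/-- The factor contributed by the wires `Q` at their end treated first, the binary digits of `i`
being their colours. The first wire has the least significant digit, so that a wire appended to `Q`
has the leading one. -/
def wireProd (y : ℕ → ℕ) : List ℕ → ℕ → ℕ
  | [], _ => 1
  | q :: Q, i => colourOk (y (q / n)) (i % 2) * wireProd y Q (i / 2)

/-- While vertex `v` is processed and the pairs of `v` with vertices below `j` have been treated,
the edge `q` is open: it has a treated left end and its right end has not been treated. -/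
def live (v j q : ℕ) : Bool :=
  adj q && decide ((q / n < v ∧ v < q % n) ∨ (q / n < v ∧ q % n = v ∧ j ≤ q / n) ∨
    (q / n = v ∧ v < q % n ∧ q % n < j))

/-- The edge `q` has been closed when vertex `v` is being processed and its pairs with vertices
below `j` have been treated. -/
def closed (v j q : ℕ) : Bool :=
  adj q && decide (q / n < q % n ∧ (q % n < v ∨ (q % n = v ∧ q / n < j)))

/-- The open edges. -/
def wires (v j : ℕ) : List ℕ := (List.range (n * n)).filter (live n adj v j)

/-- The position of the wire from `j` to `v`. -/
def wirePos (v j : ℕ) : ℕ :=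
  ((List.range (j * n + v)).filter fun q => adj q && decide (v < q % n)).length

variable {n adj}

theorem colourOk_le (x b : ℕ) : colourOk x b ≤ 1 := by
  unfold colourOk; split_ifs <;> omega

theorem compat_le (x x' : ℕ) : compat x x' ≤ 2 := by
  have h1 := Nat.mul_le_mul (colourOk_le x 0) (colourOk_le x' 0)
  have h2 := Nat.mul_le_mul (colourOk_le x 1) (colourOk_le x' 1)
  unfold compat
  omega

theorem wireProd_le (y : ℕ → ℕ) (Q : List ℕ) (i : ℕ) : wireProd n y Q i ≤ 1 := by
  induction Q generalizing i with
  | nil => rfl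
  | cons q Q ih => simpa [wireProd] using Nat.mul_le_mul (colourOk_le _ (i % 2)) (ih (i / 2))

theorem wireProd_congr {y y' : ℕ → ℕ} {Q : List ℕ} (h : ∀ q ∈ Q, y (q / n) = y' (q / n)) (i : ℕ) :
    wireProd n y Q i = wireProd n y' Q i := by
  induction Q generalizing i with
  | nil => rfl
  | cons q Q ih =>
    rw [wireProd, wireProd, h q (by simp), ih fun q' hq' => h q' (by simp [hq'])]

theorem wireProd_insert (y : ℕ → ℕ) (Q₁ Q₂ : List ℕ) (q h a l : ℕ) (ha : a < 2)
    (hl : l < 2 ^ Q₁.length) :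
    wireProd n y (Q₁ ++ q :: Q₂) (h * (2 * 2 ^ Q₁.length) + a * 2 ^ Q₁.length + l) =
      colourOk (y (q / n)) a * wireProd n y (Q₁ ++ Q₂) (h * 2 ^ Q₁.length + l) := by
  induction Q₁ generalizing l with
  | nil =>
    have : l = 0 := by simpa using hl
    subst this
    simp only [List.nil_append, List.length_nil, pow_zero, mul_one, add_zero, wireProd]
    congr 2 <;> omega
  | cons q' Q₁ ih =>
    simp only [List.cons_append, List.length_cons, pow_succ, wireProd] at hl ⊢
    set P := 2 ^ Q₁.length
    have e1 : (h * (2 * (P * 2)) + a * (P * 2) + l) = 2 * (h * (2 * P) + a * P) + l := by ring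
    have e2 : h * (P * 2) + l = 2 * (h * P) + l := by ring
    rw [e1, e2, Nat.mul_add_mod, Nat.mul_add_mod, Nat.mul_add_div (by norm_num),
      Nat.mul_add_div (by norm_num), ih _ (by omega)]
    ring

theorem wireProd_concat (y : ℕ → ℕ) (Q : List ℕ) (q b l : ℕ) (hb : b < 2)
    (hl : l < 2 ^ Q.length) :
    wireProd n y (Q ++ [q]) (b * 2 ^ Q.length + l) =
      colourOk (y (q / n)) b * wireProd n y Q l := by
  simpa using wireProd_insert (n := n) y Q [] q 0 b l hb hl

theorem lt_pair {n q j v : ℕ} (hv : v < n) (h : q < j * n + v) :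
    q / n < j ∨ (q / n = j ∧ q % n < v) := by
  have h0 : 0 < n := by omega
  have h1 := Nat.div_add_mod q n
  have h2 := Nat.mod_lt q h0
  rcases lt_trichotomy (q / n) j with h3 | h3 | h3
  · exact .inl h3
  · subst h3
    rw [mul_comm] at h1
    exact .inr ⟨rfl, by omega⟩
  · have : (j + 1) * n ≤ n * (q / n) := by rw [mul_comm]; exact Nat.mul_le_mul_left _ h3
    rw [add_mul] at this
    omega

theorem pair_lt {n q j v : ℕ} (hv : v < n) (h : j * n + v < q) :
    j < q / n ∨ (q / n = j ∧ v < q % n) := by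
  have h0 : 0 < n := by omega
  have h1 := Nat.div_add_mod q n
  have h2 := Nat.mod_lt q h0
  rcases lt_trichotomy (q / n) j with h3 | h3 | h3
  · have : (q / n + 1) * n ≤ j * n := Nat.mul_le_mul_right _ h3
    rw [add_mul, mul_comm] at this
    omega
  · subst h3
    rw [mul_comm] at h1
    exact .inr ⟨rfl, by omega⟩
  · exact .inl h3

theorem pair_div {n j v : ℕ} (hv : v < n) : (j * n + v) / n = j := by
  rw [mul_comm, Nat.mul_add_div (by omega), Nat.div_eq_of_lt hv, add_zero]

theorem pair_mod {n j v : ℕ} (hv : v < n) : (j * n + v) % n = v := by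
  rw [mul_comm, Nat.mul_add_mod, Nat.mod_eq_of_lt hv]

theorem pair_lt_sq {n j v : ℕ} (hj : j < n) (hv : v < n) : j * n + v < n * n := by
  have : (j + 1) * n ≤ n * n := Nat.mul_le_mul_right _ hj
  rw [add_mul] at this
  omega

/-- Splitting the list of all pair codes at one of them. -/
theorem range_split {N q : ℕ} (hq : q < N) :
    ∃ l : List ℕ, List.range N = List.range q ++ q :: l ∧ ∀ q' ∈ l, q < q' := by
  obtain ⟨d, rfl⟩ := Nat.exists_eq_add_of_lt hq
  refine ⟨(List.range d).map fun i => q + (i + 1), ?_, ?_⟩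
  · rw [add_assoc, List.range_add, List.range_succ_eq_map, List.map_cons, List.map_map]
    rfl
  · simp

/-- The open edges before and after the edge from `j` to `v` is closed. -/
theorem wires_remove {v j : ℕ} (hj : j < v) (hv : v < n) (ha : adj (j * n + v) = true) :
    ∃ Q₁ Q₂, wires n adj v j = Q₁ ++ (j * n + v) :: Q₂ ∧ wires n adj v (j + 1) = Q₁ ++ Q₂ ∧
      Q₁.length = wirePos n adj v j := by
  obtain ⟨l, hl, hlt⟩ := range_split (pair_lt_sq (hj.trans hv) hv)
  refine ⟨(List.range (j * n + v)).filter fun q => adj q && decide (v < q % n),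
    l.filter (live n adj v j), ?_, ?_, rfl⟩
  · rw [wires, hl, List.filter_append, List.filter_cons, if_pos]
    · congr 1
      refine List.filter_congr fun q hq => ?_
      rcases lt_pair hv (List.mem_range.1 hq) with h | h
      · unfold live; congr 1; exact decide_eq_decide.2 (by omega)
      · unfold live; congr 1; exact decide_eq_decide.2 (by omega)
    · simp [live, ha, pair_div hv, pair_mod hv, hj]
  · rw [wires, hl, List.filter_append, List.filter_cons, if_neg]
    · congr 1
      · refine List.filter_congr fun q hq => ?_
        rcases lt_pair hv (List.mem_range.1 hq) with h | h
        · unfold live; congr 1; exact decide_eq_decide.2 (by omega)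
        · unfold live; congr 1; exact decide_eq_decide.2 (by omega)
      · refine List.filter_congr fun q hq => ?_
        rcases pair_lt hv (hlt q hq) with h | h
        · unfold live; congr 1; exact decide_eq_decide.2 (by omega)
        · unfold live; congr 1; exact decide_eq_decide.2 (by omega)
    · simp only [live, ha, pair_div hv, pair_mod hv, Bool.true_and, decide_eq_true_eq]
      omega

/-- The open edges before and after the edge from `v` to `j` is opened. -/
theorem wires_add {v j : ℕ} (hj : v < j) (hjn : j < n) (ha : adj (v * n + j) = true) :
    wires n adj v (j + 1) = wires n adj v j ++ [v * n + j] := by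
  obtain ⟨l, hl, hlt⟩ := range_split (pair_lt_sq (hj.trans hjn) hjn)
  have h1 : ∀ j', j' ≤ j + 1 → l.filter (live n adj v j') = [] := by
    intro j' hj'
    refine List.filter_eq_nil_iff.2 fun q hq => ?_
    unfold live
    rcases pair_lt hjn (hlt q hq) with h | h <;>
    simp only [Bool.and_eq_true, decide_eq_true_eq, not_and] <;> omega
  rw [wires, wires, hl, List.filter_append, List.filter_cons, if_pos, List.filter_append,
    List.filter_cons, if_neg, h1 _ le_rfl, h1 _ (by omega), List.append_nil]
  · congr 1
    refine List.filter_congr fun q hq => ?_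
    rcases lt_pair hjn (List.mem_range.1 hq) with h | h
    · unfold live; congr 1; exact decide_eq_decide.2 (by omega)
    · unfold live; congr 1; exact decide_eq_decide.2 (by omega)
  · simp only [live, ha, pair_div hjn, pair_mod hjn, Bool.true_and, decide_eq_true_eq]
    omega
  · simp [live, ha, pair_div hjn, pair_mod hjn, hj]

theorem wires_skip {v j : ℕ} (h1 : adj (j * n + v) = false) (h2 : adj (v * n + j) = false) :
    wires n adj v (j + 1) = wires n adj v j := by
  refine List.filter_congr fun q _ => ?_
  by_cases hq : adj q = true
  · have h3 := Nat.div_add_mod' q n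
    unfold live
    congr 1
    refine decide_eq_decide.2 ?_
    have h4 : ¬ (q / n = j ∧ q % n = v) := by
      rintro ⟨h, h'⟩; rw [h, h'] at h3; rw [h3, hq] at h1; cases h1
    have h5 : ¬ (q / n = v ∧ q % n = j) := by
      rintro ⟨h, h'⟩; rw [h, h'] at h3; rw [h3, hq] at h2; cases h2
    omega
  · simp [live, hq]

theorem wires_next {v : ℕ} : wires n adj v n = wires n adj (v + 1) 0 := by
  refine List.filter_congr fun q hq => ?_
  have h0 : q < n * n := List.mem_range.1 hq
  have h1 := Nat.div_lt_of_lt_mul h0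
  have h3 := Nat.zero_le (q / n)
  have h2 : q % n < n := Nat.mod_lt _ (by omega)
  unfold live
  congr 1
  exact decide_eq_decide.2 (by omega)

theorem wires_zero : wires n adj 0 0 = [] := by
  refine List.filter_eq_nil_iff.2 fun q _ => ?_
  have h3 := Nat.zero_le (q / n)
  simp only [live, Bool.and_eq_true, decide_eq_true_eq]
  omega

theorem wires_last : wires n adj n 0 = [] := by
  refine List.filter_eq_nil_iff.2 fun q hq => ?_
  have h0 : q < n * n := List.mem_range.1 hq
  have h2 : q % n < n := Nat.mod_lt _ (by rcases n with _ | n <;> simp_all)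
  have h3 := Nat.zero_le (q / n)
  simp only [live, Bool.and_eq_true, decide_eq_true_eq]
  omega

end wires

/-! ### The tables -/

section tables

variable {R : Type*} [CommSemiring R] (n : ℕ) (adj : ℕ → Bool) (root : ℕ) (X : ℕ → R)

/-- The weight of the state `x` of the vertex `u`: the vertices of the cover have weight `X u`, and
states that put the root on the right or outside of the cover have weight `0`. -/
def stateWeight (u x : ℕ) : R :=
  if x = 1 then X u else if u = root then 0 else if x = 0 then 1 else X u

/-- The contribution of the closed edges. -/
def closedProd (v j : ℕ) (y : ℕ → ℕ) : ℕ :=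
  ∏ q ∈ (Finset.range (n * n)).filter (fun q => closed n adj v j q = true),
    compat (y (q / n)) (y (q % n))

/-- The table before the vertex `v` is processed. -/
def tableT (X : ℕ → ℕ) (v i : ℕ) : ℕ :=
  stateSum v fun y => (∏ u ∈ Finset.range v, stateWeight root X u (y u)) *
    closedProd n adj v 0 y * wireProd n y (wires n adj v 0) i

/-- The table while the vertex `v`, of state `x`, is processed, after its pairs with the vertices
below `j` have been treated. -/
def tableU (X : ℕ → ℕ) (v j i x : ℕ) : ℕ :=
  stateSum v fun y => (∏ u ∈ Finset.range (v + 1),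
    stateWeight root X u (Function.update y v x u)) *
    closedProd n adj v j (Function.update y v x) *
    wireProd n (Function.update y v x) (wires n adj v j) i

/-- The sum that the dynamic program computes: over all states of the vertices, the product of the
weights of the vertices and the compatibilities of the edges. -/
def total : R :=
  stateSum n fun y => (∏ u ∈ Finset.range n, stateWeight root X u (y u)) *
    (closedProd n adj n 0 y : R)

variable {n adj root}

theorem map_total {R' : Type*} [CommSemiring R'] (φ : R →+* R') :
    φ (total n adj root X) = total n adj root fun u => φ (X u) := by
  unfold total
  rw [map_stateSum]
  congr 1
  funext y
  rw [map_mul, map_prod, map_natCast]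
  congr 1
  refine Finset.prod_congr rfl fun u _ => ?_
  unfold stateWeight
  split_ifs <;> simp

theorem tableT_last (X : ℕ → ℕ) : tableT n adj root X n 0 = total n adj root X := by
  simp [tableT, total, wires_last, wireProd]

theorem tableT_zero (X : ℕ → ℕ) : tableT n adj root X 0 0 = 1 := by
  simp [tableT, stateSum, wires_zero, wireProd, closedProd, closed]

theorem tableU_zero (X : ℕ → ℕ) (v i x : ℕ) :
    tableU n adj root X v 0 i x = stateWeight root X v x * tableT n adj root X v i := by
  unfold tableU tableT
  rw [← stateSum_mul_left]
  congr 1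
  funext y
  rw [Finset.prod_range_succ, Function.update_self]
  have h1 : ∏ u ∈ Finset.range v, stateWeight root X u (Function.update y v x u) =
      ∏ u ∈ Finset.range v, stateWeight root X u (y u) := by
    refine Finset.prod_congr rfl fun u hu => ?_
    rw [Function.update_of_ne (Finset.mem_range.1 hu).ne]
  have h2 : closedProd n adj v 0 (Function.update y v x) = closedProd n adj v 0 y := by
    refine Finset.prod_congr rfl fun q hq => ?_
    simp only [closed, Finset.mem_filter, Bool.and_eq_true, decide_eq_true_eq] at hq
    have h3 := Nat.zero_le (q / n)
    rw [Function.update_of_ne (by omega), Function.update_of_ne (by omega)]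
  have h3 : wireProd n (Function.update y v x) (wires n adj v 0) i =
      wireProd n y (wires n adj v 0) i := by
    refine wireProd_congr (fun q hq => ?_) i
    simp only [wires, live, List.mem_filter, Bool.and_eq_true, decide_eq_true_eq] at hq
    rw [Function.update_of_ne (by omega)]
  rw [h1, h2, h3]
  ring

theorem tableT_succ (X : ℕ → ℕ) (v i : ℕ) : tableT n adj root X (v + 1) i =
    tableU n adj root X v n i 0 + tableU n adj root X v n i 1 + tableU n adj root X v n i 2 := by
  have h : ∀ y, closedProd n adj (v + 1) 0 y = closedProd n adj v n y := by
    intro y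
    refine Finset.prod_congr (Finset.filter_congr fun q hq => ?_) fun _ _ => rfl
    have h0 : q < n * n := Finset.mem_range.1 hq
    have h1 := Nat.div_lt_of_lt_mul h0
    have h3 := Nat.zero_le (q / n)
    unfold closed
    simp only [Bool.and_eq_true, decide_eq_true_eq]
    refine and_congr_right fun _ => ?_
    omega
  simp only [tableT, tableU, stateSum, Finset.sum_range_succ, Finset.sum_range_zero, zero_add,
    stateSum_add, h, wires_next]

theorem tableU_remove (X : ℕ → ℕ) {v j : ℕ} (hj : j < v) (hv : v < n)
    (ha : adj (j * n + v) = true) {x h l : ℕ} (hl : l < 2 ^ wirePos n adj v j) :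
    tableU n adj root X v (j + 1) (h * 2 ^ wirePos n adj v j + l) x =
      colourOk x 0 * tableU n adj root X v j (h * (2 * 2 ^ wirePos n adj v j) + l) x +
      colourOk x 1 * tableU n adj root X v j
        (h * (2 * 2 ^ wirePos n adj v j) + 2 ^ wirePos n adj v j + l) x := by
  obtain ⟨Q₁, Q₂, h1, h2, h3⟩ := wires_remove hj hv ha
  rw [← h3] at hl
  unfold tableU
  rw [← stateSum_mul_left, ← stateSum_mul_left, ← stateSum_add]
  congr 1
  funext y
  rw [h1, h2, ← h3]
  have e0 := wireProd_insert (n := n) (Function.update y v x) Q₁ Q₂ (j * n + v) h 0 l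
    (by norm_num) hl
  have e1 := wireProd_insert (n := n) (Function.update y v x) Q₁ Q₂ (j * n + v) h 1 l
    (by norm_num) hl
  rw [zero_mul, add_zero] at e0
  rw [one_mul] at e1
  rw [e0, e1]
  have hc : closedProd n adj v (j + 1) (Function.update y v x) =
      compat (Function.update y v x j) x * closedProd n adj v j (Function.update y v x) := by
    have hins : (Finset.range (n * n)).filter (fun q => closed n adj v (j + 1) q = true) =
        insert (j * n + v)
          ((Finset.range (n * n)).filter (fun q => closed n adj v j q = true)) := by
      ext q
      simp only [closed, Finset.mem_filter, Finset.mem_insert, Finset.mem_range,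
        Bool.and_eq_true, decide_eq_true_eq]
      constructor
      · rintro ⟨hq, hq', hq''⟩
        have h5 := Nat.div_add_mod' q n
        by_cases hqq : q / n = j ∧ q % n = v
        · left; rw [hqq.1, hqq.2] at h5; exact h5.symm
        · exact .inr ⟨hq, hq', by omega⟩
      · rintro (rfl | ⟨hq, hq', hq''⟩)
        · rw [pair_div hv, pair_mod hv]
          exact ⟨pair_lt_sq (hj.trans hv) hv, ha, by omega⟩
        · exact ⟨hq, hq', by omega⟩
    rw [closedProd, hins, Finset.prod_insert, pair_div hv, pair_mod hv, Function.update_self,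
      closedProd]
    simp only [closed, Finset.mem_filter, pair_div hv, pair_mod hv, Bool.and_eq_true,
      decide_eq_true_eq]
    omega
  rw [hc, pair_div hv, compat]
  ring

theorem closedProd_succ {v j : ℕ} (h : v ≤ j ∨ adj (j * n + v) = false) (y : ℕ → ℕ) :
    closedProd n adj v (j + 1) y = closedProd n adj v j y := by
  refine Finset.prod_congr (Finset.filter_congr fun q _ => ?_) fun _ _ => rfl
  unfold closed
  simp only [Bool.and_eq_true, decide_eq_true_eq]
  refine and_congr_right fun hq => ?_
  rcases h with h | h
  · omega
  · have h3 := Nat.div_add_mod' q n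
    have h4 : ¬ (q / n = j ∧ q % n = v) := by
      rintro ⟨h', h''⟩; rw [h', h''] at h3; rw [h3, hq] at h; cases h
    omega

theorem tableU_add (X : ℕ → ℕ) {v j : ℕ} (hj : v < j) (hjn : j < n)
    (ha : adj (v * n + j) = true) {x b l : ℕ} (hb : b < 2)
    (hl : l < 2 ^ (wires n adj v j).length) :
    tableU n adj root X v (j + 1) (b * 2 ^ (wires n adj v j).length + l) x =
      colourOk x b * tableU n adj root X v j l x := by
  unfold tableU
  rw [← stateSum_mul_left]
  congr 1
  funext y
  rw [wires_add hj hjn ha, wireProd_concat _ _ _ _ _ hb hl, pair_div hjn, Function.update_self,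
    closedProd_succ (.inl hj.le)]
  ring

theorem tableU_skip (X : ℕ → ℕ) {v j : ℕ} (h1 : adj (j * n + v) = false)
    (h2 : adj (v * n + j) = false) (i x : ℕ) :
    tableU n adj root X v (j + 1) i x = tableU n adj root X v j i x := by
  unfold tableU
  congr 1
  funext y
  rw [wires_skip h1 h2, closedProd_succ (.inr h1)]

theorem closedProd_le (v j : ℕ) (y : ℕ → ℕ) : closedProd n adj v j y ≤ 2 ^ (n * n) := by
  refine (Finset.prod_le_pow_card _ _ 2 fun q _ => compat_le _ _).trans ?_
  refine Nat.pow_le_pow_right (by norm_num) ?_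
  exact (Finset.card_filter_le _ _).trans (Finset.card_range _).le

theorem prod_stateWeight_le {X : ℕ → ℕ} {B : ℕ} (hB : 1 ≤ B) (hX : ∀ u < n, X u ≤ B) {v : ℕ}
    (hv : v ≤ n) (y : ℕ → ℕ) : ∏ u ∈ Finset.range v, stateWeight root X u (y u) ≤ B ^ n := by
  refine (Finset.prod_le_pow_card _ _ B fun u hu => ?_).trans ?_
  · have := hX u ((Finset.mem_range.1 hu).trans_le hv)
    unfold stateWeight
    split_ifs <;> omega
  · rw [Finset.card_range]
    exact Nat.pow_le_pow_right hB hv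

theorem tableT_le {X : ℕ → ℕ} {B : ℕ} (hB : 1 ≤ B) (hX : ∀ u < n, X u ≤ B) {v : ℕ}
    (hv : v ≤ n) (i : ℕ) : tableT n adj root X v i ≤ 3 ^ n * (B ^ n * 2 ^ (n * n)) := by
  refine (stateSum_le v (B ^ n * 2 ^ (n * n)) _ fun y => ?_).trans
    (Nat.mul_le_mul_right _ (Nat.pow_le_pow_right (by norm_num) hv))
  simpa using Nat.mul_le_mul (Nat.mul_le_mul (prod_stateWeight_le hB hX hv y)
    (closedProd_le v 0 y)) (wireProd_le y _ i)

theorem tableU_le {X : ℕ → ℕ} {B : ℕ} (hB : 1 ≤ B) (hX : ∀ u < n, X u ≤ B) {v : ℕ}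
    (hv : v < n) (j i x : ℕ) :
    tableU n adj root X v j i x ≤ 3 ^ n * (B ^ n * 2 ^ (n * n)) := by
  refine (stateSum_le v (B ^ n * 2 ^ (n * n)) _ fun y => ?_).trans
    (Nat.mul_le_mul_right _ (Nat.pow_le_pow_right (by norm_num) hv.le))
  simpa using Nat.mul_le_mul (Nat.mul_le_mul (prod_stateWeight_le hB hX hv _)
    (closedProd_le v j _)) (wireProd_le _ _ i)

end tables

/-! ### The sum modulo two counts the connected vertex covers -/

section parity

variable {n : ℕ}

/-- Two states at the ends of an edge are allowed if they are neither both `0` nor left and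
right. -/
def Allowed (a b : Fin 3) : Prop := compat a b % 2 = 1

instance (a b : Fin 3) : Decidable (Allowed a b) := inferInstanceAs (Decidable (_ = _))

theorem allowed_neg : ∀ a b : Fin 3, Allowed (-a) (-b) ↔ Allowed a b := by decide
theorem allowed_comm : ∀ a b : Fin 3, Allowed a b ↔ Allowed b a := by decide
theorem allowed_zero_neg : ∀ b : Fin 3, Allowed 0 (-b) ↔ Allowed 0 b := by decide
theorem not_allowed_zero : ¬ Allowed 0 0 := by decide
theorem Allowed.eq_one : ∀ {b : Fin 3}, Allowed 1 b → b ≠ 0 → b = 1 := by decide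
theorem allowed_ite : ∀ (p q : Prop) [Decidable p] [Decidable q], p ∨ q →
    Allowed (if p then 1 else 0) (if q then 1 else 0) := by
  intro p q _ _ h
  by_cases hp : p <;> by_cases hq : q <;> simp [hp, hq] at h ⊢ <;> decide
theorem neg_ne_self_of_ne_zero : ∀ {a : Fin 3}, a ≠ 0 → -a ≠ a := by decide

/-- The assignments of states that respect all edges and put the root to the left. -/
def Consistent (G : SimpleGraph (Fin n)) (root : Fin n) (y : Fin n → Fin 3) : Prop :=
  y root = 1 ∧ ∀ u v, G.Adj u v → Allowed (y u) (y v)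

/-- The vertices of nonzero state. -/
def coverOf (y : Fin n → Fin 3) : Finset (Fin n) := Finset.univ.filter fun u => y u ≠ 0

theorem mem_coverOf {y : Fin n → Fin 3} {u : Fin n} : u ∈ coverOf y ↔ y u ≠ 0 := by
  simp [coverOf]

variable {G : SimpleGraph (Fin n)} {root : Fin n} {y : Fin n → Fin 3}

theorem Consistent.isVertexCover (h : Consistent G root y) :
    G.IsVertexCover (coverOf y : Set (Fin n)) := by
  intro u v huv
  by_contra hc
  simp only [Finset.mem_coe, mem_coverOf, not_or, not_not] at hc
  have := h.2 u v huv
  rw [hc.1, hc.2] at this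
  exact not_allowed_zero this

theorem Consistent.root_mem (h : Consistent G root y) : root ∈ coverOf y := by
  simp [mem_coverOf, h.1]

/-- In a consistent assignment, everything reachable from the root is on its side. -/
theorem Consistent.eq_one_of_reachable (h : Consistent G root y)
    {a b : {u // u ∈ (coverOf y : Set (Fin n))}}
    (hab : (G.induce (coverOf y : Set (Fin n))).Reachable a b) (ha : y a = 1) : y b = 1 := by
  obtain ⟨w⟩ := hab
  induction w with
  | nil => exact ha
  | @cons a c b hac _ ih =>
    refine ih ?_
    have h1 := h.2 _ _ (show G.Adj a c from hac)
    rw [ha] at h1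
    exact h1.eq_one (mem_coverOf.1 c.2)

/-- The vertices outside of `S`, and those in the component of the root in `G[S]`. -/
def Near (G : SimpleGraph (Fin n)) (root : Fin n) (S : Finset (Fin n)) (u : Fin n) : Prop :=
  ∀ (hr : root ∈ S) (hu : u ∈ S),
    (G.induce (S : Set (Fin n))).Reachable ⟨root, hr⟩ ⟨u, hu⟩

open Classical in
/-- Exchange left and right in all components of `G[S]` but that of the root. -/
noncomputable def flipFar (G : SimpleGraph (Fin n)) (root : Fin n) (S : Finset (Fin n))
    (y : Fin n → Fin 3) (u : Fin n) : Fin 3 :=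
  if Near G root S u then y u else -y u

theorem coverOf_flipFar (S : Finset (Fin n)) : coverOf (flipFar G root S y) = coverOf y := by
  ext u
  simp only [mem_coverOf, flipFar]
  split_ifs <;> simp

theorem flipFar_flipFar (S : Finset (Fin n)) :
    flipFar G root S (flipFar G root S y) = y := by
  funext u
  simp only [flipFar]
  split_ifs <;> simp

theorem Consistent.flipFar (h : Consistent G root y) :
    Consistent G root (flipFar G root (coverOf y) y) := by
  constructor
  · rw [CutwidthCVC.flipFar, if_pos, h.1]
    intro _ _
    exact SimpleGraph.Reachable.refl _
  · intro u v huv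
    have h1 := h.2 u v huv
    unfold CutwidthCVC.flipFar
    by_cases hu0 : y u = 0
    · rw [hu0] at h1 ⊢
      split_ifs <;> simpa [allowed_zero_neg] using h1
    by_cases hv0 : y v = 0
    · rw [hv0] at h1 ⊢
      rw [allowed_comm] at h1 ⊢
      split_ifs <;> simpa [allowed_zero_neg] using h1
    have hadj : (G.induce (coverOf y : Set (Fin n))).Adj ⟨u, mem_coverOf.2 hu0⟩
        ⟨v, mem_coverOf.2 hv0⟩ := huv
    have hiff : Near G root (coverOf y) u ↔ Near G root (coverOf y) v :=
      ⟨fun hn hr _ => (hn hr _).trans hadj.reachable,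
        fun hn hr _ => (hn hr _).trans hadj.symm.reachable⟩
    by_cases hn : Near G root (coverOf y) u
    · rwa [if_pos hn, if_pos (hiff.1 hn)]
    · rwa [if_neg hn, if_neg (mt hiff.2 hn), allowed_neg]

/-- The assignment that puts all of `S` to the left. -/
def allLeft (S : Finset (Fin n)) (u : Fin n) : Fin 3 := if u ∈ S then 1 else 0

open Classical in
/-- Modulo two, the number of consistent assignments with a given cover is one if the cover is
connected and zero otherwise: if it is not connected, `flipFar` pairs up the assignments. -/
theorem card_consistent {R : Type*} [CommRing R] [CharP R 2] (G : SimpleGraph (Fin n))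
    (root : Fin n) (S : Finset (Fin n)) :
    ∑ y : Fin n → Fin 3 with Consistent G root y ∧ coverOf y = S, (1 : R) =
      if IsConnectedVertexCover G S ∧ root ∈ S then 1 else 0 := by
  split_ifs with h
  · obtain ⟨⟨hcov, hcon⟩, hr⟩ := h
    have hS : coverOf (allLeft S) = S := by
      ext u; simp [mem_coverOf, allLeft]
    have : Finset.univ.filter (fun y => Consistent G root y ∧ coverOf y = S) = {allLeft S} := by
      ext y
      simp only [Finset.mem_filter, Finset.mem_univ, true_and, Finset.mem_singleton]
      constructor
      · rintro ⟨hy, rfl⟩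
        funext u
        unfold allLeft
        split_ifs with hu
        · exact hy.eq_one_of_reachable (hcon.preconnected ⟨root, hr⟩ ⟨u, hu⟩) hy.1
        · simpa [mem_coverOf] using hu
      · rintro rfl
        refine ⟨⟨by simp [allLeft, hr], fun u v huv => ?_⟩, hS⟩
        exact allowed_ite _ _ (hcov huv)
    rw [this, Finset.sum_singleton]
  · refine Finset.sum_involution (fun y _ => flipFar G root S y) ?_ ?_ ?_ ?_
    · intro _ _
      -- the two partners under the involution cancel as the characteristic is two
      have := CharP.cast_eq_zero R 2
      rw [Nat.cast_two] at this
      rw [← this]; norm_num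
    · intro y hy _ heq
      simp only [Finset.mem_filter, Finset.mem_univ, true_and] at hy
      obtain ⟨hy, rfl⟩ := hy
      -- a fixed point has no vertex away from the component of the root: its cover is connected
      refine h ⟨⟨hy.isVertexCover, ?_⟩, hy.root_mem⟩
      have hn : ∀ u, u ∈ coverOf y → Near G root (coverOf y) u := by
        intro u hu
        by_contra hn
        have := congrFun heq u
        rw [flipFar, if_neg hn] at this
        exact neg_ne_self_of_ne_zero (mem_coverOf.1 hu) this
      have : Nonempty (coverOf y : Set (Fin n)) := ⟨⟨root, hy.root_mem⟩⟩
      refine ⟨fun a b => ?_⟩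
      exact (hn a a.2 hy.root_mem a.2).symm.trans (hn b b.2 hy.root_mem b.2)
    · intro y hy
      simp only [Finset.mem_filter, Finset.mem_univ, true_and] at hy ⊢
      obtain ⟨hy, rfl⟩ := hy
      exact ⟨hy.flipFar, coverOf_flipFar _⟩
    · intro y _
      exact flipFar_flipFar S

/-- The states of all positions, extended by `0`. -/
def extend (y : Fin n → Fin 3) (i : ℕ) : ℕ := if h : i < n then (y ⟨i, h⟩ : ℕ) else 0

theorem extend_coe (y : Fin n → Fin 3) (u : Fin n) : extend y u = y u := by
  simp [extend]

variable {adj : ℕ → Bool}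

open Classical in
theorem cast_closedProd {R : Type*} [CommRing R] [CharP R 2] (G : SimpleGraph (Fin n))
    (hadj : ∀ u v : Fin n, adj (u * n + v) = true ↔ G.Adj u v) (y : Fin n → Fin 3) :
    (closedProd n adj n 0 (extend y) : R) =
      if ∀ u v, G.Adj u v → Allowed (y u) (y v) then 1 else 0 := by
  have hcast : ∀ a b : Fin 3, (compat a b : R) = if Allowed a b then 1 else 0 := by
    intro a b
    rw [CharP.cast_eq_mod R 2]
    unfold Allowed
    rcases Nat.mod_two_eq_zero_or_one (compat a b) with h | h <;> simp [h]
  rw [closedProd, Nat.cast_prod]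
  split_ifs with h
  · refine Finset.prod_eq_one fun q hq => ?_
    simp only [closed, Finset.mem_filter, Finset.mem_range, Bool.and_eq_true,
      decide_eq_true_eq] at hq
    have h1 : q / n < n := Nat.div_lt_of_lt_mul hq.1
    have h2 : q % n < n := Nat.mod_lt _ (by rcases n with _ | n <;> simp_all)
    have h3 : G.Adj ⟨q / n, h1⟩ ⟨q % n, h2⟩ := by
      rw [← hadj]
      simpa [Nat.div_add_mod'] using hq.2.1
    have h4 := hcast (y ⟨q / n, h1⟩) (y ⟨q % n, h2⟩)
    rw [if_pos (h _ _ h3), ← extend_coe, ← extend_coe] at h4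
    exact h4
  · push Not at h
    obtain ⟨u, v, huv, hna⟩ := h
    wlog hlt : u < v generalizing u v
    · rw [allowed_comm] at hna
      exact this v u huv.symm hna (lt_of_le_of_ne (not_lt.1 hlt) huv.ne')
    refine Finset.prod_eq_zero (i := (u : ℕ) * n + v) ?_ ?_
    · simp only [closed, Finset.mem_filter, Finset.mem_range, Bool.and_eq_true,
        decide_eq_true_eq, pair_div v.2, pair_mod v.2]
      refine ⟨pair_lt_sq u.2 v.2, (hadj u v).2 huv, ?_⟩
      have := v.2
      have : (u : ℕ) < v := hlt
      omega
    · rw [pair_div v.2, pair_mod v.2, extend_coe, extend_coe, hcast, if_neg hna]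

theorem prod_stateWeight {R : Type*} [CommRing R] (X : ℕ → R) (root : Fin n)
    (y : Fin n → Fin 3) :
    ∏ u ∈ Finset.range n, stateWeight root X u (extend y u) =
      if y root = 1 then ∏ u ∈ coverOf y, X u else 0 := by
  rw [Finset.prod_range]
  split_ifs with h
  · rw [coverOf, Finset.prod_filter]
    refine Finset.prod_congr rfl fun u _ => ?_
    rw [extend_coe]
    unfold stateWeight
    by_cases hu : u = root
    · subst hu; simp [h]
    · have : (u : ℕ) ≠ root := fun h => hu (Fin.ext h)
      by_cases h1 : y u = 1
      · simp [h1]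
      · have h1' : (y u : ℕ) ≠ 1 := fun h => h1 (Fin.ext h)
        have h0 : ((y u : ℕ) = 0) ↔ y u = 0 := by rw [Fin.ext_iff]; rfl
        simp [h1', this, h0]
  · refine Finset.prod_eq_zero (Finset.mem_univ root) ?_
    have h1' : (y root : ℕ) ≠ 1 := fun h' => h (Fin.ext h')
    rw [extend_coe]
    simp [stateWeight, h1']

open Classical in
/-- In characteristic two, the sum computed by the dynamic program is the generating function of
the connected vertex covers that contain the root. -/
theorem total_eq_sum {R : Type*} [CommRing R] [CharP R 2] (G : SimpleGraph (Fin n))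
    (hadj : ∀ u v : Fin n, adj (u * n + v) = true ↔ G.Adj u v) (root : Fin n) (X : ℕ → R) :
    total n adj root X = ∑ S : Finset (Fin n) with IsConnectedVertexCover G S ∧ root ∈ S,
      ∏ u ∈ S, X u := by
  rw [total, stateSum_eq_sum]
  have h : ∀ y : Fin n → Fin 3, (∏ u ∈ Finset.range n, stateWeight root X u (extend y u)) *
      (closedProd n adj n 0 (extend y) : R) =
      ∑ S : Finset (Fin n),
        if Consistent G root y ∧ coverOf y = S then ∏ u ∈ S, X u else 0 := by
    intro y
    rw [prod_stateWeight, cast_closedProd G hadj]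
    by_cases hc : Consistent G root y
    · rw [if_pos hc.1, if_pos hc.2, mul_one]
      simp [hc]
    · rw [ite_zero_mul_ite_zero]
      refine (if_neg hc).trans ?_
      simp [hc]
  refine (Finset.sum_congr rfl fun y _ => h y).trans ?_
  rw [Finset.sum_comm, Finset.sum_filter]
  refine Finset.sum_congr rfl fun S _ => ?_
  have h3 := congrArg (· * ∏ u ∈ S, X u) (card_consistent (R := R) G root S)
  simp only [Finset.sum_mul, one_mul, ite_mul, zero_mul] at h3
  rw [← h3, Finset.sum_filter]

end parity

/-! ### Random weights -/

/-- The number whose binary digits are the `b` coins from position `p` on. -/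
def bitsVal (r : ℕ → Bool) (p : ℕ) : ℕ → ℕ
  | 0 => 0
  | b + 1 => 2 * bitsVal r p b + if r (p + b) then 1 else 0

theorem bitsVal_lt (r : ℕ → Bool) (p b : ℕ) : bitsVal r p b < 2 ^ b := by
  induction b with
  | zero => simp [bitsVal]
  | succ b ih =>
    rw [bitsVal, pow_succ]
    split_ifs <;> omega

theorem eq_of_bitsVal_eq {r r' : ℕ → Bool} {p b : ℕ} (h : bitsVal r p b = bitsVal r' p b) :
    ∀ i < b, r (p + i) = r' (p + i) := by
  induction b with
  | zero => simp
  | succ b ih =>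
    simp only [bitsVal] at h
    have h1 : r (p + b) = r' (p + b) := by
      cases h1 : r (p + b) <;> cases h2 : r' (p + b) <;> simp [h1, h2] at h ⊢ <;> omega
    rw [h1] at h
    intro i hi
    rcases Nat.lt_succ_iff_lt_or_eq.1 hi with hi | rfl
    · exact ih (by omega) i hi
    · exact h1

theorem coins_cylinder (r₀ : ℕ → Bool) (m : ℕ) :
    coins {r | ∀ i < m, r i = r₀ i} = (1 / 2) ^ m := by
  have h : {r : ℕ → Bool | ∀ i < m, r i = r₀ i} =
      Set.pi (Finset.range m : Set ℕ) fun i => {r₀ i} := by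
    ext r; simp
  rw [h, coins, Measure.infinitePi_pi _ fun i _ => MeasurableSet.singleton _]
  simp only [PMF.toMeasure_apply_singleton _ _ (MeasurableSet.singleton _)]
  simp

/-- Disjoint blocks of `b` coins take given values with probability `(1 / 2) ^ (n * b)` (or `0` if
some value is too large). -/
theorem coins_weights_le (n b : ℕ) (w : Fin n → ℕ) :
    coins {r | ∀ i : Fin n, bitsVal r (i * b) b = w i} ≤ (1 / 2) ^ (n * b) := by
  by_cases h : ∃ r₀, ∀ i : Fin n, bitsVal r₀ (i * b) b = w i
  · obtain ⟨r₀, h0⟩ := h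
    rw [← coins_cylinder r₀]
    refine measure_mono fun r hr t ht => ?_
    have hb : 0 < b := by
      rcases b with _ | b
      · simp at ht
      · omega
    have ht' : t / b < n := Nat.div_lt_of_lt_mul (by rwa [mul_comm])
    have := eq_of_bitsVal_eq ((hr ⟨t / b, ht'⟩).trans (h0 ⟨t / b, ht'⟩).symm) (t % b)
      (Nat.mod_lt _ hb)
    simpa [Nat.div_add_mod'] using this
  · push Not at h
    have : {r | ∀ i : Fin n, bitsVal r (i * b) b = w i} = ∅ := by
      ext r
      simpa using h r
    rw [this]
    simp

open Polynomial in
/-- The generating function of a family of sets by total weight. -/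
noncomputable def weightGen {n : ℕ} (F : Finset (Finset (Fin n))) (w : Fin n → ℕ) : (ZMod 2)[X] :=
  ∑ S ∈ F, X ^ ∑ u ∈ S, w u

open Polynomial in
/-- By the Schwartz–Zippel lemma, applied to the powers of the indeterminate with exponents below
`N`, the weights for which the generating function of a nonempty family vanishes are few. -/
theorem card_bad_weights {n : ℕ} {F : Finset (Finset (Fin n))} (hF : F.Nonempty) (N : ℕ)
    (hN : 2 * n ≤ N) (hN0 : 0 < N) :
    2 * (Finset.univ.filter fun w : Fin n → Fin N =>
      weightGen F (fun u => (w u : ℕ)) = 0).card ≤ N ^ n := by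
  classical
  set ind : Finset (Fin n) → (Fin n →₀ ℕ) := fun S => Finsupp.indicator S fun _ _ => 1 with hind
  have hinj : Function.Injective ind := by
    intro S S' h
    ext u
    have := DFunLike.congr_fun h u
    simp only [hind, Finsupp.indicator_apply] at this
    by_cases h1 : u ∈ S <;> by_cases h2 : u ∈ S' <;> simp_all
  -- the multilinear polynomial of the family, of total degree at most `n`; the generating function
  -- is its value at the powers of the indeterminate given by the weights
  set p : MvPolynomial (Fin n) (ZMod 2)[X] := ∑ S ∈ F, MvPolynomial.monomial (ind S) 1 with hp
  have hp0 : p ≠ 0 := by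
    obtain ⟨S, hS⟩ := hF
    intro h0
    have h1 := congrArg (MvPolynomial.coeff (ind S)) h0
    rw [hp, MvPolynomial.coeff_sum, Finset.sum_eq_single S] at h1
    · simp at h1
    · intro S' _ hne
      rw [MvPolynomial.coeff_monomial, if_neg (hinj.ne hne)]
    · exact fun h => absurd hS h
  have hdeg : p.totalDegree ≤ n := by
    refine MvPolynomial.totalDegree_finsetSum_le fun S _ => ?_
    refine (MvPolynomial.totalDegree_monomial_le _ _).trans ?_
    rw [Finsupp.sum_fintype _ _ (fun _ => rfl)]
    refine (Finset.sum_le_card_nsmul _ _ 1 fun u _ => ?_).trans (by simp)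
    simp only [hind, Finsupp.indicator_apply]
    split_ifs <;> simp
  have heval : ∀ w : Fin n → ℕ, MvPolynomial.eval (fun u => (X ^ w u : (ZMod 2)[X])) p =
      weightGen F w := by
    intro w
    rw [hp, map_sum, weightGen]
    refine Finset.sum_congr rfl fun S _ => ?_
    rw [MvPolynomial.eval_monomial, one_mul, Finsupp.prod_fintype _ _ (fun _ => pow_zero _),
      ← Finset.prod_pow_eq_pow_sum, ← Finset.prod_subset (Finset.subset_univ S)]
    · refine Finset.prod_congr rfl fun u hu => ?_
      simp [hind, Finsupp.indicator_apply, hu]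
    · intro u _ hu
      simp [hind, Finsupp.indicator_apply, hu]
  set P : Finset (ZMod 2)[X] := (Finset.range N).image fun i => X ^ i with hP
  have hXinj : Function.Injective fun i : ℕ => (X ^ i : (ZMod 2)[X]) := by
    intro i j h
    have := congrArg natDegree h
    simpa using this
  have hPc : P.card = N := by
    rw [hP, Finset.card_image_of_injective _ hXinj, Finset.card_range]
  have hle : (Finset.univ.filter fun w : Fin n → Fin N =>
      weightGen F (fun u => (w u : ℕ)) = 0).card ≤
      ((Fintype.piFinset fun _ : Fin n => P).filter fun f => MvPolynomial.eval f p = 0).card := by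
    refine Finset.card_le_card_of_injOn (fun w u => X ^ (w u : ℕ)) ?_ ?_
    · intro w hw
      simp only [Finset.coe_filter, Finset.mem_univ, true_and, Set.mem_ofPred_eq,
        Fintype.mem_piFinset] at hw ⊢
      refine ⟨fun u => ?_, (heval _).trans hw⟩
      exact Finset.mem_image_of_mem _ (Finset.mem_range.2 (w u).2)
    · intro w _ w' _ h
      funext u
      exact Fin.ext (hXinj (congrFun h u))
  have hsz := MvPolynomial.schwartz_zippel_totalDegree hp0 P
  rw [hPc] at hsz
  have hNpos : (0 : ℚ≥0) < N := by exact_mod_cast hN0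
  rw [div_le_div_iff₀ (by positivity) hNpos] at hsz
  have hsz' : ((Fintype.piFinset fun _ : Fin n => P).filter
      fun f => MvPolynomial.eval f p = 0).card * N ≤ p.totalDegree * N ^ n := by
    exact_mod_cast hsz
  -- the fraction of bad weights is at most `n / N`, hence at most one half
  refine Nat.le_of_mul_le_mul_right (c := N) ?_ hN0
  calc _ ≤ 2 * (((Fintype.piFinset fun _ : Fin n => P).filter
      fun f => MvPolynomial.eval f p = 0).card * N) := by
        rw [mul_assoc]; exact Nat.mul_le_mul_left _ (Nat.mul_le_mul_right _ hle)
    _ ≤ 2 * (n * N ^ n) := Nat.mul_le_mul_left _ (hsz'.trans (Nat.mul_le_mul_right _ hdeg))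
    _ ≤ N ^ n * N := by nlinarith [Nat.mul_le_mul_right (N ^ n) hN]

/-- With probability at least one half, random weights of `b` bits make the generating function of
a nonempty family nonzero. -/
theorem coins_weightGen_eq_zero {n : ℕ} {F : Finset (Finset (Fin n))} (hF : F.Nonempty) (b : ℕ)
    (hb : 2 * n ≤ 2 ^ b) :
    coins {r | weightGen F (fun u => bitsVal r (u * b) b) = 0} ≤ 1 / 2 := by
  classical
  set W := Finset.univ.filter fun w : Fin n → Fin (2 ^ b) => weightGen F (fun u => (w u : ℕ)) = 0
  have hW : 2 * W.card ≤ (2 ^ b) ^ n := card_bad_weights hF (2 ^ b) hb (by positivity)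
  calc coins {r | weightGen F (fun u => bitsVal r (u * b) b) = 0}
      ≤ coins (⋃ w ∈ W, {r | ∀ i : Fin n, bitsVal r (i * b) b = (w i : ℕ)}) := by
        refine measure_mono fun r hr => ?_
        simp only [Set.mem_iUnion]
        exact ⟨fun u => ⟨bitsVal r (u * b) b, bitsVal_lt _ _ _⟩, by simpa [W] using hr,
          fun _ => rfl⟩
    _ ≤ ∑ w ∈ W, coins {r | ∀ i : Fin n, bitsVal r (i * b) b = (w i : ℕ)} :=
        measure_biUnion_finset_le _ _
    _ ≤ ∑ w ∈ W, (1 / 2) ^ (n * b) := Finset.sum_le_sum fun w _ => coins_weights_le n b _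
    _ = W.card * (1 / 2) ^ (n * b) := by rw [Finset.sum_const, nsmul_eq_mul]
    _ ≤ 1 / 2 := by
        have h2 : ((2 * W.card : ℕ) : ℝ≥0∞) ≤ ((2 ^ (n * b) : ℕ) : ℝ≥0∞) := by
          rw [mul_comm n b, pow_mul]; exact_mod_cast hW
        push_cast at h2
        rw [one_div, ENNReal.le_inv_iff_mul_le, ← ENNReal.inv_pow, mul_right_comm, mul_comm _ 2,
          ← ENNReal.le_inv_iff_mul_le]
        simpa using h2

/-! ### Reading off the answer from the binary digits of the sum -/

open Polynomial in
/-- A polynomial whose coefficients are smaller than `B` is determined by its value at `B`. -/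
theorem eval_div_pow_mod {B : ℕ} (P : ℕ[X]) (hP : ∀ i, P.coeff i < B) (j : ℕ) :
    P.eval B / B ^ j % B = P.coeff j := by
  induction j generalizing P with
  | zero =>
    conv_lhs => rw [← divX_mul_X_add P]
    simp [Nat.mod_eq_of_lt (hP 0)]
  | succ j ih =>
    have hB : 0 < B := (Nat.zero_le _).trans_lt (hP 0)
    have h1 : P.eval B / B = P.divX.eval B := by
      conv_lhs => rw [← divX_mul_X_add P]
      rw [eval_add, eval_mul, eval_X, eval_C, mul_comm, Nat.mul_add_div hB,
        Nat.div_eq_of_lt (hP 0), add_zero]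
    rw [pow_succ', ← Nat.div_div_eq_div_mul, h1, ih _ fun i => by simpa using hP (i + 1),
      coeff_divX]

section extraction

variable {n : ℕ} {adj : ℕ → Bool} {G : SimpleGraph (Fin n)}

/-- The base in which the table entries are read as polynomials. For `n > 0`, it exceeds the
number of all choices of states and colours, and thus all coefficients, and it is even, so that the
parity of a digit is that of the shifted number. -/
def base (n : ℕ) : ℕ := 2 ^ (n * (n + 2))

/-- Larger than all total weights if the single weights are smaller than `N`. The position of a
digit is `shift * size + weight`, so that size and weight are its quotient and remainder. -/
def shift (n N : ℕ) : ℕ := n * N + 1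

theorem three_pow_lt_base (hn : 0 < n) : 3 ^ n * 2 ^ (n * n) < base n := by
  have h1 : (3 : ℕ) ^ n < 4 ^ n := Nat.pow_lt_pow_left (by norm_num) hn.ne'
  have h2 : base n = 4 ^ n * 2 ^ (n * n) := by
    rw [base, show (4 : ℕ) = 2 ^ 2 by norm_num, ← pow_mul, ← pow_add]
    congr 1; ring
  rw [h2]
  exact Nat.mul_lt_mul_of_pos_right h1 (by positivity)

open Polynomial in
open Classical in
/-- The digits of the number computed by the dynamic program have the parity of the numbers of
connected vertex covers with given size and weight. -/
theorem cast_digit (hadj : ∀ u v : Fin n, adj (u * n + v) = true ↔ G.Adj u v) (root : Fin n)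
    (e : ℕ → ℕ) (j : ℕ) :
    ((total n adj root (fun u => base n ^ e u) / base n ^ j % 2 : ℕ) : ZMod 2) =
      ∑ S : Finset (Fin n) with IsConnectedVertexCover G S ∧ root ∈ S,
        if ∑ u ∈ S, e u = j then 1 else 0 := by
  have hn : 0 < n := root.pos
  set P : ℕ[X] := total n adj root fun u => X ^ e u with hP
  have h1 : total n adj root (fun u => base n ^ e u) = P.eval (base n) := by
    rw [← coe_evalRingHom, hP, map_total]
    simp
  have h2 : P.eval 1 ≤ 3 ^ n * 2 ^ (n * n) := by
    rw [← coe_evalRingHom, hP, map_total]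
    have := tableT_le (n := n) (adj := adj) (root := root) (X := fun _ => 1) (B := 1) le_rfl
      (fun _ _ => le_rfl) (le_refl n) 0
    rw [tableT_last] at this
    simpa using this
  have h3 : ∀ i, P.coeff i < base n := by
    intro i
    refine lt_of_le_of_lt ?_ (h2.trans_lt (three_pow_lt_base hn))
    rw [eval_eq_sum, Polynomial.sum]
    simp only [one_pow, mul_one]
    by_cases hi : i ∈ P.support
    · exact Finset.single_le_sum (f := fun i => P.coeff i) (fun _ _ => Nat.zero_le _) hi
    · rw [notMem_support_iff.1 hi]; exact Nat.zero_le _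
  have h4 : 2 ∣ base n := dvd_pow_self 2 (by positivity)
  rw [h1, ← Nat.mod_mod_of_dvd _ h4, eval_div_pow_mod P h3, ZMod.natCast_mod]
  have h5 : P.map (Nat.castRingHom (ZMod 2)) = total n adj root fun u => X ^ e u := by
    rw [← coe_mapRingHom, hP, map_total]
    simp
  rw [← eq_natCast (Nat.castRingHom (ZMod 2)), ← coeff_map, h5, total_eq_sum G hadj root,
    finsetSum_coeff]
  refine Finset.sum_congr rfl fun S _ => ?_
  rw [Finset.prod_pow_eq_pow_sum, coeff_X_pow]
  simp only [eq_comm]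

/-- The condition for acceptance, in terms of the table entries: for some root, some digit of the
final entry with an admissible size is odd. -/
def Detected (n : ℕ) (adj : ℕ → Bool) (φ : ℕ → ℕ → Prop) (N : ℕ) (w : ℕ → ℕ) (k : ℕ) : Prop :=
  ∃ root < n, ∃ j < (n + 1) * shift n N, φ (j / shift n N) k ∧
    total n adj root (fun u => base n ^ (shift n N + w u)) / base n ^ j % 2 = 1

theorem sum_weight_lt_shift {N : ℕ} {w : ℕ → ℕ} (hw : ∀ u < n, w u < N) (S : Finset (Fin n)) :
    ∑ u ∈ S, w u < shift n N := by
  refine Nat.lt_succ_of_le ((Finset.sum_le_card_nsmul S _ N fun u _ => (hw u u.2).le).trans ?_)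
  rw [smul_eq_mul]
  exact Nat.mul_le_mul_right _ (by simpa using Finset.card_le_univ S)

/-- There are no false positives: an odd digit is a nonempty sum over covers, and the position of
the digit, which is `shift * size + weight` for each of them, reveals their size. -/
theorem Detected.exists_cover {φ : ℕ → ℕ → Prop} {N : ℕ} {w : ℕ → ℕ} {k : ℕ}
    (hadj : ∀ u v : Fin n, adj (u * n + v) = true ↔ G.Adj u v) (hw : ∀ u < n, w u < N)
    (h : Detected n adj φ N w k) : ∃ S, IsConnectedVertexCover G S ∧ φ S.card k := by
  classical
  obtain ⟨root, hr, j, hj, hφ, h1⟩ := h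
  have h2 := cast_digit hadj ⟨root, hr⟩ (fun u => shift n N + w u) j
  rw [h1, Nat.cast_one] at h2
  have h3 := (Finset.exists_ne_zero_of_sum_ne_zero (by rw [← h2]; exact one_ne_zero))
  obtain ⟨S, hS, h4⟩ := h3
  refine ⟨S, (Finset.mem_filter.1 hS).2.1, ?_⟩
  have h5 : ∑ u ∈ S, (shift n N + w u) = j := by
    by_contra hc
    rw [if_neg hc] at h4
    exact h4 rfl
  rw [Finset.sum_add_distrib, Finset.sum_const, smul_eq_mul] at h5
  rwa [← h5, mul_comm, Nat.mul_add_div (show 0 < shift n N from Nat.succ_pos _),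
    Nat.div_eq_of_lt (sum_weight_lt_shift hw S), add_zero] at hφ

open Classical in
/-- The connected vertex covers of size `k` that contain the root. -/
noncomputable def coversAt (G : SimpleGraph (Fin n)) (root : Fin n) (k : ℕ) :
    Finset (Finset (Fin n)) :=
  Finset.univ.filter fun S => (IsConnectedVertexCover G S ∧ root ∈ S) ∧ S.card = k

open Polynomial in
/-- If the covers of an admissible size do not cancel, then one of the digits that belong to this
size is odd: these digits are the coefficients of the generating function. -/
theorem detected_of_weightGen_ne_zero {φ : ℕ → ℕ → Prop} {N : ℕ} {w : ℕ → ℕ} {k k₀ : ℕ}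
    (hadj : ∀ u v : Fin n, adj (u * n + v) = true ↔ G.Adj u v) (hw : ∀ u < n, w u < N)
    (hφ : φ k₀ k) (root : Fin n)
    (h : weightGen (coversAt G root k₀) (fun u => w u) ≠ 0) : Detected n adj φ N w k := by
  classical
  obtain ⟨i, hi⟩ : ∃ i, (weightGen (coversAt G root k₀) fun u => w u).coeff i ≠ 0 := by
    by_contra hc
    push Not at hc
    exact h (Polynomial.ext hc)
  rw [weightGen, finsetSum_coeff] at hi
  obtain ⟨S₀, hS₀, h1⟩ := Finset.exists_ne_zero_of_sum_ne_zero hi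
  have hi0 : i < shift n N := by
    rw [coeff_X_pow] at h1
    by_cases hc : i = ∑ u ∈ S₀, w u
    · rw [hc]; exact sum_weight_lt_shift hw S₀
    · rw [if_neg hc] at h1; exact absurd rfl h1
  have hk : k₀ ≤ n := by
    rw [← (Finset.mem_filter.1 hS₀).2.2]
    simpa using Finset.card_le_univ S₀
  have hD : 0 < shift n N := Nat.succ_pos _
  refine ⟨root, root.2, shift n N * k₀ + i, ?_, ?_, ?_⟩
  · calc shift n N * k₀ + i < shift n N * k₀ + shift n N := by omega
      _ = (k₀ + 1) * shift n N := by ring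
      _ ≤ _ := Nat.mul_le_mul_right _ (by omega)
  · rwa [Nat.mul_add_div hD, Nat.div_eq_of_lt hi0, add_zero]
  · have h2 := cast_digit hadj root (fun u => shift n N + w u) (shift n N * k₀ + i)
    have h3 : (∑ S : Finset (Fin n) with IsConnectedVertexCover G S ∧ root ∈ S,
        if ∑ u ∈ S, (shift n N + w u) = shift n N * k₀ + i then (1 : ZMod 2) else 0) =
        ∑ S ∈ coversAt G root k₀, (X ^ ∑ u ∈ S, w u : (ZMod 2)[X]).coeff i := by
      rw [coversAt, ← Finset.filter_filter (fun S => IsConnectedVertexCover G S ∧ root ∈ S),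
        Finset.sum_filter (fun S : Finset (Fin n) => S.card = k₀)]
      refine Finset.sum_congr rfl fun S _ => ?_
      rw [Finset.sum_add_distrib, Finset.sum_const, smul_eq_mul, coeff_X_pow, ← ite_and]
      refine if_congr ?_ rfl rfl
      have hlt := sum_weight_lt_shift hw S
      constructor
      · intro h
        have h4 := congrArg (· / shift n N) h
        have h5 := congrArg (· % shift n N) h
        simp only [mul_comm S.card, Nat.mul_add_div hD, Nat.mul_add_mod, Nat.div_eq_of_lt hlt,
          Nat.div_eq_of_lt hi0, Nat.mod_eq_of_lt hlt, Nat.mod_eq_of_lt hi0] at h4 h5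
        exact ⟨by omega, h5.symm⟩
      · rintro ⟨h4, h5⟩
        rw [h4, h5, mul_comm]
    rw [h3] at h2
    rw [← h2] at hi
    rcases Nat.mod_two_eq_zero_or_one (total n adj root
      (fun u => base n ^ (shift n N + w u)) / base n ^ (shift n N * k₀ + i)) with h4 | h4
    · rw [h4] at hi
      exact absurd Nat.cast_zero hi
    · exact h4

end extraction

/-! ### The program for one step of the dynamic program

All programs share one allocation of memory. The arrays `0` and `1` are the input, the arrangement
and the adjacency matrix; array `2` is the adjacency matrix of the positions, `3` the weights `X`,
`4` the table `tableT`, `5` the table `tableU` with the entry of index `i` and state `x` in the cell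
`3 * i + x`, and `6` a buffer. The variables `0` and `1` hold `n` and `k`, `2` is the loop variable
of `tab`, `3` the number of colourings of the wires, `5` the current vertex, `6` its current
partner, `7` the root, and `16` the answer, which is moved to `0` in the end. -/

instance : Add Expr := ⟨.op .add⟩
instance : Sub Expr := ⟨.op .sub⟩
instance : Mul Expr := ⟨.op .mul⟩
instance : Div Expr := ⟨.op .div⟩
instance : Mod Expr := ⟨.op .mod⟩
instance (c : ℕ) : OfNat Expr c := ⟨.lit c⟩

/-- The test `e₁ < e₂`. -/
def Expr.lt (e₁ e₂ : Expr) : Expr := .op .lt e₁ e₂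

/-- The test `e₁ = e₂`. -/
def Expr.eq (e₁ e₂ : Expr) : Expr := .op .eq e₁ e₂

section evalLemmas
variable (s : State) (e₁ e₂ : Expr)

@[simp] theorem Expr.eval_add : (e₁ + e₂).eval s = e₁.eval s + e₂.eval s := rfl
@[simp] theorem Expr.eval_sub : (e₁ - e₂).eval s = e₁.eval s - e₂.eval s := rfl
@[simp] theorem Expr.eval_mul : (e₁ * e₂).eval s = e₁.eval s * e₂.eval s := rfl
@[simp] theorem Expr.eval_div : (e₁ / e₂).eval s = e₁.eval s / e₂.eval s := rfl
@[simp] theorem Expr.eval_mod : (e₁ % e₂).eval s = e₁.eval s % e₂.eval s := rfl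
@[simp] theorem Expr.eval_ofNat (c : ℕ) : (no_index (OfNat.ofNat c) : Expr).eval s = c := rfl
@[simp] theorem Expr.eval_var (x : ℕ) : (Expr.var x).eval s = s.var x := rfl
@[simp] theorem Expr.eval_get (a : ℕ) (e : Expr) : (Expr.get a e).eval s = s.arr a (e.eval s) := rfl
@[simp] theorem Expr.eval_lt :
    (Expr.lt e₁ e₂).eval s = if e₁.eval s < e₂.eval s then 1 else 0 := rfl
@[simp] theorem Expr.eval_eq :
    (Expr.eq e₁ e₂).eval s = if e₁.eval s = e₂.eval s then 1 else 0 := rfl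

end evalLemmas

/-- The expression for `colourOk`. -/
def okExpr (x b : Expr) : Expr := 1 - .eq (x + b) 2

@[simp] theorem eval_okExpr (s : State) (x b : Expr) :
    (okExpr x b).eval s = colourOk (x.eval s) (b.eval s) := by
  simp only [okExpr, Expr.eval_sub, Expr.eval_eq, Expr.eval_add, Expr.eval_ofNat,
    colourOk]
  split_ifs with h <;> simp [h]

/-- Close the edge from `j` to `v`: variable `3` holds the number of colourings of the wires,
variable `4` receives two to the power of the position of the wire, array `5` holds the table and
array `6` is a buffer. The new entries are sums of two old ones whose indices arise by inserting
the digit `0` or `1` at this position. -/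
def removeWire : Prog :=
  .seq (.assign 4 1) <|
  .seq (forLoop 17 (.var 6 * .var 0 + .var 5)
    (.ite (.get 2 (.var 17) * .lt (.var 5) (.var 17 % .var 0)) (.assign 4 (.var 4 + .var 4))
      .skip)) <|
  .seq (.assign 3 (.var 3 / 2)) <|
  .seq (tab 6 (3 * .var 3)
    (okExpr (.var 2 % 3) 0 *
        .get 5 (3 * (.var 2 / 3 / .var 4 * (2 * .var 4) + .var 2 / 3 % .var 4) + .var 2 % 3) +
      okExpr (.var 2 % 3) 1 *
        .get 5 (3 * (.var 2 / 3 / .var 4 * (2 * .var 4) + .var 4 + .var 2 / 3 % .var 4) +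
          .var 2 % 3))) <|
  tab 5 (3 * .var 3) (.get 6 (.var 2))

/-- Open the edge from `v` to `j`. Its colour becomes the leading digit of the index. -/
def addWire : Prog :=
  .seq (tab 6 (6 * .var 3)
    (okExpr (.var 2 % 3) (.var 2 / 3 / .var 3) *
      .get 5 (3 * (.var 2 / 3 % .var 3) + .var 2 % 3))) <|
  .seq (.assign 3 (.var 3 + .var 3)) <|
  tab 5 (3 * .var 3) (.get 6 (.var 2))

/-- Treat the pair of `j` and `v`. -/
def treatPair : Prog :=
  .ite (.get 2 (.var 6 * .var 0 + .var 5)) (.ite (.lt (.var 6) (.var 5)) removeWire addWire) .skip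

/-- Process the vertex `v`, held in variable `5`; the table in array `4` is updated. -/
def processVertex : Prog :=
  .seq (tab 5 (3 * .var 3)
    ((.eq (.var 2 % 3) 1 * .get 3 (.var 5) +
      (1 - .eq (.var 5) (.var 7)) *
        (.eq (.var 2 % 3) 0 + .eq (.var 2 % 3) 2 * .get 3 (.var 5))) * .get 4 (.var 2 / 3))) <|
  .seq (forLoop 6 (.var 0) treatPair) <|
  tab 4 (.var 3) (.get 5 (3 * .var 2) + .get 5 (3 * .var 2 + 1) + .get 5 (3 * .var 2 + 2))

section verification

variable {r : ℕ → Bool} {L n B K : ℕ} {adj : ℕ → Bool} {X : ℕ → ℕ} {root : ℕ}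

/-- The number of vertices, the adjacency matrix of the positions and the weights are in their
places. -/
structure Ready (n : ℕ) (adj : ℕ → Bool) (X : ℕ → ℕ) (s : State) : Prop where
  n_eq : s.var 0 = n
  adj_eq : ∀ q < n * n, s.arr 2 q = if adj q then 1 else 0
  X_eq : ∀ u < n, s.arr 3 u = X u

theorem Ready.frame {s s' : State} {p : Prog} (h : Ready n adj X s) (hf : Frame p s s')
    (h0 : p.writesVar 0 = false) (h2 : p.writesArr 2 = false) (h3 : p.writesArr 3 = false) :
    Ready n adj X s' :=
  ⟨(hf.var 0 h0).trans h.n_eq, fun q hq => by rw [hf.arr 2 h2, h.adj_eq q hq],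
    fun u hu => by rw [hf.arr 3 h3, h.X_eq u hu]⟩

/-- The numbers below which everything stays: `X u ≤ B` for all vertices `u`, there are always at
most `K` colourings of the wires, and all numbers have at most `L` bits. -/
structure Limits (n : ℕ) (adj : ℕ → Bool) (X : ℕ → ℕ) (B K L : ℕ) : Prop where
  one_le : 1 ≤ B
  X_le : ∀ u < n, X u ≤ B
  sq_le : n * n + 3 ≤ L
  table_lt : 3 ^ n * (B ^ n * 2 ^ (n * n)) < 2 ^ L
  wires_le : ∀ v < n, ∀ j ≤ n, 2 ^ (wires n adj v j).length ≤ K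

/-- The current table of the vertex `v` after treating the pairs below `j` is in array `5`. -/
structure Loaded (n : ℕ) (adj : ℕ → Bool) (root : ℕ) (X : ℕ → ℕ) (v j : ℕ) (s : State) :
    Prop where
  size_eq : s.var 3 = 2 ^ (wires n adj v j).length
  table_eq : ∀ i < 3 * 2 ^ (wires n adj v j).length,
    s.arr 5 i = tableU n adj root X v j (i / 3) (i % 3)

theorem two_pow_wires_le (v j : ℕ) : 2 ^ (wires n adj v j).length ≤ 2 ^ (n * n) :=
  Nat.pow_le_pow_right (by norm_num) <| by
    simpa [wires] using List.length_filter_le _ (List.range (n * n))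

theorem Limits.pow_le (h : Limits n adj X B K L) : 8 * 2 ^ (n * n) ≤ 2 ^ L := by
  have h1 : 2 ^ (n * n + 3) ≤ 2 ^ L := Nat.pow_le_pow_right (by norm_num) h.sq_le
  rw [pow_add] at h1
  omega

theorem Limits.sq_lt (h : Limits n adj X B K L) : n * n < 2 ^ L := by
  have := h.pow_le
  have := Nat.lt_two_pow_self (n := n * n)
  omega

theorem Limits.lt (h : Limits n adj X B K L) : n < 2 ^ L := by
  have := h.sq_lt
  have : n ≤ n * n := Nat.le_mul_self n
  omega

theorem removeWire_spec (hl : Limits n adj X B K L) {s : State} (hR : Ready n adj X s) {v j : ℕ}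
    (hv : s.var 5 = v) (hj : s.var 6 = j) (hjv : j < v) (hvn : v < n)
    (ha : adj (j * n + v) = true) (hs : Loaded n adj root X v j s) :
    Tri r L removeWire s (4 * (n * n) + 18 * K + 20) (Loaded n adj root X v (j + 1)) := by
  obtain ⟨Q₁, Q₂, e1, e2, e3⟩ := wires_remove hjv hvn ha
  have hlen : (wires n adj v j).length = (wires n adj v (j + 1)).length + 1 := by
    rw [e1, e2]; simp only [List.length_append, List.length_cons]; omega
  have hpos : wirePos n adj v j ≤ (wires n adj v (j + 1)).length := by
    rw [← e3, e2]; simp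
  set P := 2 ^ wirePos n adj v j with hP
  set M := 2 ^ (wires n adj v (j + 1)).length with hM
  have hP0 : 0 < P := by positivity
  obtain ⟨c, hc⟩ : P ∣ M := pow_dvd_pow 2 hpos
  have hMle : M ≤ 2 ^ (n * n) := two_pow_wires_le v (j + 1)
  have hMK : M ≤ K := hl.wires_le v hvn (j + 1) (by omega)
  have hpow := hl.pow_le
  have hMM : 2 ^ (wires n adj v j).length = 2 * M := by rw [hlen, pow_succ']
  have hjv2 : j * n + v < n * n := pair_lt_sq (hjv.trans hvn) hvn
  have hsq := hl.sq_lt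
  -- inserting a digit into an index of the new table gives an index of the old one
  have hidx : ∀ i < 3 * M, i / 3 / P * (2 * P) + P + i / 3 % P < 2 * M := by
    intro i hi
    have h1 : i / 3 < P * c := by rw [← hc]; omega
    have h2 : i / 3 / P < c := Nat.div_lt_of_lt_mul h1
    have h3 : i / 3 % P < P := Nat.mod_lt _ hP0
    have h4 : (i / 3 / P + 1) * (2 * P) ≤ c * (2 * P) := Nat.mul_le_mul_right _ h2
    rw [hc]
    nlinarith
  refine Tri.conseq (T := 1 + (((j * n + v) * (2 + 2) + 2) + (1 + ((3 * M * 3 + 2) +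
    (3 * M * 3 + 2))))) ?_ (fun _ _ h => h) (by omega)
  refine Tri.seq (Q' := fun s' => s'.var 4 = 1)
    (Tri.assign (v := 1) rfl (by omega) (by simp)) fun s₁ f₁ h₁ => ?_
  have hn1 : s₁.var 0 = n := (f₁.var 0 rfl).trans hR.n_eq
  have hv1 : s₁.var 5 = v := (f₁.var 5 rfl).trans hv
  have hj1 : s₁.var 6 = j := (f₁.var 6 rfl).trans hj
  refine Tri.seq (Q' := fun s' => s'.var 4 = P)
    (Tri.forLoop (T := 2) (fun i s' => s'.var 4 =
      2 ^ ((List.range i).filter fun q => adj q && decide (v < q % n)).length) rfl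
      (hjv2.trans hsq) ?_ ?_ ?_) fun s₂ f₂ h₂ => ?_
  · intro s' hf
    simp only [Expr.eval_add, Expr.eval_mul, Expr.eval_var]
    rw [hf.var 0 rfl, hf.var 5 rfl, hf.var 6 rfl, hn1, hv1, hj1]
  · simpa using h₁
  · intro i hi s' hI hxi hf
    have hn' : s'.var 0 = n := (hf.var 0 rfl).trans hn1
    have hv' : s'.var 5 = v := (hf.var 5 rfl).trans hv1
    have hadj : s'.arr 2 i = if adj i then 1 else 0 := by
      rw [hf.arr 2 rfl, f₁.arr 2 rfl, hR.adj_eq i (by omega)]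
    have hcond : (Expr.get 2 (.var 17) * .lt (.var 5) (.var 17 % .var 0)).eval s' =
        if (adj i && decide (v < i % n)) = true then 1 else 0 := by
      simp only [Expr.eval_mul, Expr.eval_get, Expr.eval_var, Expr.eval_lt, Expr.eval_mod, hxi,
        hn', hv', hadj]
      by_cases h1 : adj i = true <;> by_cases h2 : v < i % n <;> simp [h1, h2]
    rw [List.range_succ, List.filter_append, List.length_append]
    refine Tri.ite (fun he => ?_) (fun he => ?_)
    · have hq : (adj i && decide (v < i % n)) = true := by
        by_contra hq; exact he (by rw [hcond, if_neg hq])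
      have hle : ((List.range i).filter fun q => adj q && decide (v < q % n)).length ≤ i := by
        simpa using List.length_filter_le (fun q => adj q && decide (v < q % n)) (List.range i)
      have hle2 := Nat.pow_le_pow_right (n := 2) (by norm_num) (hle.trans (by omega : i ≤ n * n))
      refine Tri.assign (v := 2 * s'.var 4) (by simp [two_mul]) (by rw [hI]; omega) ?_
      simp only [State.setVar_var, List.filter_cons, hq, if_true, List.filter_nil,
        List.length_cons, List.length_nil, zero_add, pow_succ, hI]
      simp [mul_comm]
    · have hq : ¬ (adj i && decide (v < i % n)) = true := by
        intro hq; rw [hcond, if_pos hq] at he; cases he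
      refine Tri.skip ?_
      simp [hq, hI]
  have hM1 : s₂.var 3 = 2 * M := by
    rw [f₂.var 3 rfl, f₁.var 3 rfl, hs.size_eq, hMM]
  refine Tri.seq (Q' := fun s' => s'.var 3 = M)
    (Tri.assign (v := M) (by simp [hM1]) (by omega) (by simp)) fun s₃ f₃ h₃ => ?_
  have hP3 : s₃.var 4 = P := (f₃.var 4 rfl).trans h₂
  have hT3 : ∀ i < 3 * (2 * M), s₃.arr 5 i = tableU n adj root X v j (i / 3) (i % 3) := by
    intro i hi
    rw [f₃.arr 5 rfl, f₂.arr 5 rfl, f₁.arr 5 rfl, hs.table_eq i (by rw [hMM]; exact hi)]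
  refine Tri.seq (Tri.tab (m := 3 * M) (fun i => tableU n adj root X v (j + 1) (i / 3) (i % 3))
    (by omega) ?_ ?_ fun i _ => (tableU_le hl.one_le hl.X_le hvn _ _ _).trans_lt hl.table_lt)
    fun s₄ f₄ h₄ => ?_
  · intro s' hf
    simp [hf.var 3 rfl, h₃]
  · intro i hi s' hf hxi
    have hi2 := hidx i hi
    have hx : i % 3 < 3 := Nat.mod_lt _ (by norm_num)
    simp only [Expr.eval_add, Expr.eval_mul, eval_okExpr, Expr.eval_mod, Expr.eval_div,
      Expr.eval_var, Expr.eval_ofNat, Expr.eval_get, hxi,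
      hf.var 4 rfl, hf.arr 5 rfl, hP3]
    rw [hT3 _ (by omega), hT3 _ (by omega), Nat.mul_add_div (by norm_num),
      Nat.mul_add_div (by norm_num), Nat.mul_add_mod, Nat.mul_add_mod, Nat.div_eq_of_lt hx,
      Nat.mod_eq_of_lt hx, add_zero, add_zero, ← tableU_remove X hjv hvn ha (Nat.mod_lt _ hP0),
      Nat.div_add_mod']
  have h3' : s₄.var 3 = M := (f₄.var 3 rfl).trans h₃
  refine (Tri.tab (m := 3 * M) (fun i => tableU n adj root X v (j + 1) (i / 3) (i % 3))
    (by omega) ?_ ?_ fun i _ => (tableU_le hl.one_le hl.X_le hvn _ _ _).trans_lt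
      hl.table_lt).conseq ?_ le_rfl
  · intro s' hf
    simp [hf.var 3 rfl, h3']
  · intro i hi s' hf hxi
    simp only [Expr.eval_get, Expr.eval_var, hxi, hf.arr 6 rfl]
    rw [h₄, if_pos hi]
  · intro s' hf h
    exact ⟨(hf.var 3 rfl).trans h3', fun i hi => by rw [h, if_pos hi]⟩

theorem addWire_spec (hl : Limits n adj X B K L) {s : State} {v j : ℕ}
    (hvj : v < j) (hjn : j < n)
    (ha : adj (v * n + j) = true) (hs : Loaded n adj root X v j s) :
    Tri r L addWire s (18 * K + 20) (Loaded n adj root X v (j + 1)) := by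
  have hvn : v < n := hvj.trans hjn
  set M := 2 ^ (wires n adj v j).length with hM
  have hMM : 2 ^ (wires n adj v (j + 1)).length = 2 * M := by
    rw [wires_add hvj hjn ha, List.length_append, List.length_singleton, pow_succ']
  have hM0 : 0 < M := by positivity
  have hMle : 2 * M ≤ 2 ^ (n * n) := hMM ▸ two_pow_wires_le v (j + 1)
  have hMK : 2 * M ≤ K := hMM ▸ hl.wires_le v hvn (j + 1) (by omega)
  have hpow := hl.pow_le
  refine Tri.conseq (T := (6 * M * 3 + 2) + (1 + (3 * (2 * M) * 3 + 2))) ?_ (fun _ _ h => h)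
    (by omega)
  refine Tri.seq (Tri.tab (m := 6 * M) (fun i => tableU n adj root X v (j + 1) (i / 3) (i % 3))
    (by omega) ?_ ?_ fun i _ => (tableU_le hl.one_le hl.X_le hvn _ _ _).trans_lt hl.table_lt)
    fun s₁ f₁ h₁ => ?_
  · intro s' hf
    simp [hf.var 3 rfl, hs.size_eq, hM]
  · intro i hi s' hf hxi
    have hx : i % 3 < 3 := Nat.mod_lt _ (by norm_num)
    have hy : i / 3 / M < 2 := Nat.div_lt_of_lt_mul (by omega)
    have hz : i / 3 % M < M := Nat.mod_lt _ hM0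
    simp only [Expr.eval_add, Expr.eval_mul, eval_okExpr, Expr.eval_mod, Expr.eval_div,
      Expr.eval_var, Expr.eval_ofNat, Expr.eval_get, hxi,
      hf.var 3 rfl, hf.arr 5 rfl, hs.size_eq]
    rw [hs.table_eq _ (by omega), Nat.mul_add_div (by norm_num), Nat.mul_add_mod,
      Nat.div_eq_of_lt hx, Nat.mod_eq_of_lt hx, add_zero, ← tableU_add X hvj hjn ha hy hz,
      Nat.div_add_mod']
  refine Tri.seq (Q' := fun s' => s'.var 3 = 2 * M)
    (Tri.assign (v := 2 * M) ?_ (by omega) (by simp)) fun s₂ f₂ h₂ => ?_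
  · simp [f₁.var 3 rfl, hs.size_eq, ← hM, two_mul]
  refine (Tri.tab (m := 3 * (2 * M)) (fun i => tableU n adj root X v (j + 1) (i / 3) (i % 3))
    (by omega) ?_ ?_ fun i _ => (tableU_le hl.one_le hl.X_le hvn _ _ _).trans_lt
      hl.table_lt).conseq ?_ le_rfl
  · intro s' hf
    simp [hf.var 3 rfl, h₂]
  · intro i hi s' hf hxi
    simp only [Expr.eval_get, Expr.eval_var, hxi, hf.arr 6 rfl, f₂.arr 6 rfl]
    rw [h₁, if_pos (by omega)]
  · intro s' hf h
    exact ⟨by rw [hf.var 3 rfl, h₂, hMM], fun i hi => by rw [h, if_pos (by rw [← hMM]; exact hi)]⟩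

theorem treatPair_spec (hl : Limits n adj X B K L)
    (hsymm : ∀ u < n, ∀ v < n, adj (u * n + v) = adj (v * n + u))
    (hirr : ∀ v < n, adj (v * n + v) = false) {s : State} (hR : Ready n adj X s) {v j : ℕ}
    (hv : s.var 5 = v) (hj : s.var 6 = j) (hvn : v < n) (hjn : j < n)
    (hs : Loaded n adj root X v j s) :
    Tri r L treatPair s (4 * (n * n) + 18 * K + 22) (Loaded n adj root X v (j + 1)) := by
  have hcond : (Expr.get 2 (.var 6 * .var 0 + .var 5)).eval s =
      if adj (j * n + v) then 1 else 0 := by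
    simp only [Expr.eval_get, Expr.eval_add, Expr.eval_mul, Expr.eval_var, hv, hj, hR.n_eq]
    exact hR.adj_eq _ (pair_lt_sq hjn hvn)
  refine Tri.ite (T := 4 * (n * n) + 18 * K + 21) (fun he => ?_) (fun he => ?_)
  · have ha : adj (j * n + v) = true := by
      by_contra h; exact he (by rw [hcond, if_neg h])
    refine Tri.ite (fun he => ?_) (fun he => ?_)
    · have hjv : j < v := by
        by_contra h; exact he (by simp [hv, hj, h])
      exact removeWire_spec hl hR hv hj hjv hvn ha hs
    · have hjv : ¬ j < v := by
        intro h; simp [hv, hj, h] at he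
      have hne : j ≠ v := by
        rintro rfl; rw [hirr j hjn] at ha; cases ha
      exact (addWire_spec hl (by omega) hjn (by rw [hsymm v hvn j hjn]; exact ha) hs).conseq
        (fun _ _ h => h) (by omega)
  · have ha : adj (j * n + v) = false := by
      by_contra h
      rw [hcond, if_pos (by simpa using h)] at he
      cases he
    have ha' : adj (v * n + j) = false := by rw [hsymm v hvn j hjn]; exact ha
    refine (Tri.skip (Q := Loaded n adj root X v (j + 1)) ?_).conseq (fun _ _ h => h) (by omega)
    have hw := wires_skip ha ha'
    refine ⟨by rw [hw]; exact hs.size_eq, fun i hi => ?_⟩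
    rw [hw] at hi
    rw [hs.table_eq i hi, tableU_skip X ha ha']

/-- The table before the vertex `v` is processed is in array `4`. -/
structure TableAt (n : ℕ) (adj : ℕ → Bool) (root : ℕ) (X : ℕ → ℕ) (v : ℕ) (s : State) :
    Prop where
  size_eq : s.var 3 = 2 ^ (wires n adj v 0).length
  table_eq : ∀ i < 2 ^ (wires n adj v 0).length, s.arr 4 i = tableT n adj root X v i

theorem processVertex_spec (hl : Limits n adj X B K L)
    (hsymm : ∀ u < n, ∀ v < n, adj (u * n + v) = adj (v * n + u))
    (hirr : ∀ v < n, adj (v * n + v) = false) {s : State} (hR : Ready n adj X s) {v : ℕ}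
    (hv : s.var 5 = v) (hr : s.var 7 = root) (hvn : v < n)
    (hs : TableAt n adj root X v s) :
    Tri r L processVertex s (n * (4 * (n * n) + 18 * K + 24) + 12 * K + 6)
      (TableAt n adj root X (v + 1)) := by
  have hpow := hl.pow_le
  set M := 2 ^ (wires n adj v 0).length with hM
  set M' := 2 ^ (wires n adj v n).length with hM'
  have hMle : M ≤ 2 ^ (n * n) := two_pow_wires_le v 0
  have hMK : M ≤ K := hl.wires_le v hvn 0 (by omega)
  have hMle' : M' ≤ 2 ^ (n * n) := two_pow_wires_le v n
  have hMK' : M' ≤ K := hl.wires_le v hvn n le_rfl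
  have hpos : 0 < 2 ^ (n * n) := by positivity
  refine Tri.conseq (T := (3 * M * 3 + 2) + ((n * (4 * (n * n) + 18 * K + 22 + 2) + 2) +
    (M' * 3 + 2))) ?_ (fun _ _ h => h)
    (by rw [add_assoc (4 * (n * n) + 18 * K) 22 2]; omega)
  refine Tri.seq (Tri.tab (m := 3 * M) (fun i => tableU n adj root X v 0 (i / 3) (i % 3))
    (by omega) ?_ ?_ fun i _ => (tableU_le hl.one_le hl.X_le hvn _ _ _).trans_lt hl.table_lt)
    fun s₁ f₁ h₁ => ?_
  · intro s' hf
    simp [hf.var 3 rfl, hs.size_eq, hM]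
  · intro i hi s' hf hxi
    have hx : i % 3 < 3 := Nat.mod_lt _ (by norm_num)
    simp only [Expr.eval_add, Expr.eval_sub, Expr.eval_mul, Expr.eval_mod, Expr.eval_div,
      Expr.eval_var, Expr.eval_ofNat, Expr.eval_eq, Expr.eval_get,
      hxi, hf.var 5 rfl, hf.var 7 rfl, hf.arr 3 rfl, hf.arr 4 rfl, hv, hr]
    rw [hs.table_eq _ (by omega), tableU_zero, hR.X_eq v hvn]
    congr 1
    unfold stateWeight
    generalize i % 3 = x at hx
    by_cases hvr : v = root
    · interval_cases x <;> simp [hvr]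
    · interval_cases x <;> simp [hvr]
  have hR1 : Ready n adj X s₁ := hR.frame f₁ rfl rfl rfl
  have hv1 : s₁.var 5 = v := (f₁.var 5 rfl).trans hv
  have hs1 : Loaded n adj root X v 0 s₁ :=
    ⟨(f₁.var 3 rfl).trans hs.size_eq, fun i hi => by rw [h₁, if_pos hi]⟩
  refine Tri.seq (Tri.forLoop (fun j s' => Loaded n adj root X v j s') rfl hl.lt ?_ ?_ ?_)
    fun s₂ f₂ h₂ => ?_
  · intro s' hf
    simp [hf.var 0 rfl, hR1.n_eq]
  · exact ⟨by simpa using hs1.size_eq, hs1.table_eq⟩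
  · intro j hj s' hI hxj hf
    refine (treatPair_spec hl hsymm hirr (hR1.frame hf rfl rfl rfl) ((hf.var 5 rfl).trans hv1)
      hxj hvn hj hI).conseq (fun s'' _ h => ?_) le_rfl
    exact ⟨by simpa using h.size_eq, h.table_eq⟩
  refine (Tri.tab (m := M') (fun i => tableT n adj root X (v + 1) i) (by omega) ?_ ?_
    fun i _ => (tableT_le hl.one_le hl.X_le hvn _).trans_lt hl.table_lt).conseq ?_ le_rfl
  · intro s' hf
    simp [hf.var 3 rfl, h₂.size_eq, hM']
  · intro i hi s' hf hxi
    simp only [Expr.eval_get, Expr.eval_add, Expr.eval_mul, Expr.eval_ofNat,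
      Expr.eval_var, hxi, hf.arr 5 rfl]
    rw [h₂.table_eq _ (by omega), h₂.table_eq _ (by omega), h₂.table_eq _ (by omega), tableT_succ,
      Nat.mul_add_div (by norm_num), Nat.mul_add_mod, Nat.mul_add_div (by norm_num),
      Nat.mul_add_mod, Nat.mul_mod_right, Nat.mul_div_cancel_left _ (by norm_num)]
    rfl
  · intro s' hf h
    have hw := wires_next (n := n) (adj := adj) (v := v)
    refine ⟨by rw [hf.var 3 rfl, h₂.size_eq, hw], fun i hi => ?_⟩
    rw [h, if_pos (by rw [hM', hw]; exact hi)]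

end verification

/-! ### The program for all roots -/

/-- Run the dynamic program for the root in variable `7` and set variable `16` if some digit of the
result, in the base in variable `11`, is odd and passes the test, which refers to the position `17`
of the digit. -/
def testRoot (test : Expr) : Prog :=
  .seq (.store 4 0 1) <|
  .seq (.assign 3 1) <|
  .seq (forLoop 5 (.var 0) processVertex) <|
  .seq (.assign 8 (.get 4 0)) <|
  forLoop 17 ((.var 0 + 1) * .var 13) <|
  .seq (.ite (.var 8 % 2 * test) (.assign 16 1) .skip) (.assign 8 (.var 8 / .var 11))

/-- Set variable `16` if the test succeeds for some root. -/
def testRoots (test : Expr) : Prog :=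
  .seq (.assign 16 0) (forLoop 7 (.var 0) (testRoot test))

section verification

variable {r : ℕ → Bool} {L n B K : ℕ} {adj : ℕ → Bool} {X : ℕ → ℕ} {Z D k : ℕ}
  {test : Expr} {φ : ℕ → ℕ → Prop}

/-- A bound for the number of steps of `processVertex`. -/
def vertexSteps (n K : ℕ) : ℕ := n * (4 * (n * n) + 18 * K + 24) + 12 * K + 6

/-- A bound for the number of steps of `testRoot`. -/
def rootSteps (n K D : ℕ) : ℕ := n * (vertexSteps n K + 2) + (n + 1) * D * 5 + 7

theorem testRoot_spec (hl : Limits n adj X B K L)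
    (hsymm : ∀ u < n, ∀ v < n, adj (u * n + v) = adj (v * n + u))
    (hirr : ∀ v < n, adj (v * n + v) = false)
    (htest : ∀ s : State, test.eval s ≠ 0 ↔ φ (s.var 17 / s.var 13) (s.var 1))
    (hD : (n + 1) * D < 2 ^ L) {s : State} (hR : Ready n adj X s) {root : ℕ}
    (hr : s.var 7 = root) (hZ : s.var 11 = Z) (hD13 : s.var 13 = D) (hk : s.var 1 = k) :
    Tri r L (testRoot test) s (rootSteps n K D) fun s' =>
      (s'.var 16 = 1 ↔ s.var 16 = 1 ∨
        ∃ j < (n + 1) * D, φ (j / D) k ∧ total n adj root X / Z ^ j % 2 = 1) := by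
  have hpow := hl.pow_le
  have hpos : 0 < 2 ^ (n * n) := by positivity
  refine Tri.conseq (T := 1 + (1 + ((n * (vertexSteps n K + 2) + 2) + (1 +
    ((n + 1) * D * (3 + 2) + 2))))) ?_ (fun _ _ h => h) (by unfold rootSteps; omega)
  refine Tri.seq (Q' := fun s' => s'.arr 4 0 = 1)
    (Tri.store (i := 0) (v := 1) rfl rfl (by omega) (by simp)) fun s₁ f₁ h₁ => ?_
  refine Tri.seq (Q' := fun s' => s'.var 3 = 1)
    (Tri.assign (v := 1) rfl (by omega) (by simp)) fun s₂ f₂ h₂ => ?_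
  have hR2 : Ready n adj X s₂ := (hR.frame f₁ rfl rfl rfl).frame f₂ rfl rfl rfl
  refine Tri.seq (Tri.forLoop (fun v s' => TableAt n adj root X v s') rfl hl.lt ?_ ?_ ?_)
    fun s₃ f₃ h₃ => ?_
  · intro s' hf
    simp [hf.var 0 rfl, hR2.n_eq]
  · refine ⟨by simp [h₂, wires_zero], fun i hi => ?_⟩
    have : i = 0 := by simpa [wires_zero] using hi
    subst this
    rw [State.setVar_arr, f₂.arr 4 rfl, h₁, tableT_zero]
  · intro v hv s' hI hxv hf
    refine (processVertex_spec hl hsymm hirr (hR2.frame hf rfl rfl rfl) hxv ?_ hv hI).conseq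
      (fun s'' _ h => ⟨by simpa using h.size_eq, h.table_eq⟩) le_rfl
    rw [hf.var 7 rfl, f₂.var 7 rfl, f₁.var 7 rfl, hr]
  have htot : s₃.arr 4 0 = total n adj root X := by
    rw [h₃.table_eq 0 (by positivity), tableT_last]
  have hlt : total n adj root X < 2 ^ L := by
    rw [← tableT_last]
    exact (tableT_le hl.one_le hl.X_le le_rfl _).trans_lt hl.table_lt
  refine Tri.seq (Q' := fun s' => s'.var 8 = total n adj root X)
    (Tri.assign (v := total n adj root X) htot hlt (by simp)) fun s₄ f₄ h₄ => ?_
  have hvar : ∀ x, x ≠ 2 → x ≠ 3 → x ≠ 4 → x ≠ 5 → x ≠ 6 → x ≠ 8 → x ≠ 17 →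
      s₄.var x = s.var x := by
    intro x h2 h3 h4 h5 h6 h8 h17
    rw [f₄.var x (by simp [Prog.writesVar, h8]), f₃.var x (by
        simp [forLoop, Prog.writesVar, processVertex, treatPair, removeWire, addWire, tab, *]),
      f₂.var x (by simp [Prog.writesVar, h3]), f₁.var x rfl]
  refine (Tri.forLoop (fun i s' => s'.var 8 = total n adj root X / Z ^ i ∧
    (s'.var 16 = 1 ↔ s.var 16 = 1 ∨
        ∃ j < i, φ (j / D) k ∧ total n adj root X / Z ^ j % 2 = 1)) rfl hD ?_ ?_ ?_).conseq
    (fun _ _ h => h.2) le_rfl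
  · intro s' hf
    simp [hf.var 0 rfl, hf.var 13 rfl, hvar, hR.n_eq, hD13]
  · simp [h₄, hvar]
  · rintro i hi s' ⟨hI1, hI2⟩ hxi hf
    have e1 : s'.var 1 = k := by rw [hf.var 1 rfl, hvar 1] <;> simp [hk]
    have e13 : s'.var 13 = D := by rw [hf.var 13 rfl, hvar 13] <;> simp [hD13]
    have e11 : s'.var 11 = Z := by rw [hf.var 11 rfl, hvar 11] <;> simp [hZ]
    have hcond : (Expr.var 8 % 2 * test).eval s' ≠ 0 ↔
        φ (i / D) k ∧ total n adj root X / Z ^ i % 2 = 1 := by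
      rw [Expr.eval_mul, mul_ne_zero_iff, htest, hxi, e1, e13, Expr.eval_mod, Expr.eval_var, hI1,
        Expr.eval_ofNat, Nat.mod_two_ne_zero, and_comm]
    have hstep : (∃ j < i + 1, φ (j / D) k ∧ total n adj root X / Z ^ j % 2 = 1) ↔
        (φ (i / D) k ∧ total n adj root X / Z ^ i % 2 = 1) ∨
        ∃ j < i, φ (j / D) k ∧ total n adj root X / Z ^ j % 2 = 1 := by
      constructor
      · rintro ⟨j, hj, h⟩
        rcases Nat.lt_succ_iff_lt_or_eq.1 hj with hj | rfl
        exacts [.inr ⟨j, hj, h⟩, .inl h]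
      · rintro (h | ⟨j, hj, h⟩)
        exacts [⟨i, by omega, h⟩, ⟨j, by omega, h⟩]
    refine Tri.seq (T := 2) (T' := 1) (Q' := fun s'' => s''.var 16 = 1 ↔ s.var 16 = 1 ∨
        ∃ j < i + 1, φ (j / D) k ∧ total n adj root X / Z ^ j % 2 = 1)
      (Tri.ite (fun he => ?_) (fun he => ?_)) fun s'' f'' h'' => ?_
    · refine Tri.assign (v := 1) rfl (by omega) ?_
      simp only [State.setVar_var, if_true, true_iff]
      exact .inr (hstep.2 (.inl (hcond.1 he)))
    · refine Tri.skip ?_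
      rw [hI2, hstep, or_iff_right (fun h => hcond.2 h he)]
    · refine Tri.assign (v := total n adj root X / Z ^ (i + 1)) ?_
        ((Nat.div_le_self _ _).trans_lt hlt) ?_
      · rw [Expr.eval_div, Expr.eval_var, Expr.eval_var, f''.var 8 rfl, f''.var 11 rfl, hI1, e11,
          pow_succ, Nat.div_div_eq_div_mul]
      · simpa using h''

theorem testRoots_spec (hl : Limits n adj X B K L)
    (hsymm : ∀ u < n, ∀ v < n, adj (u * n + v) = adj (v * n + u))
    (hirr : ∀ v < n, adj (v * n + v) = false)
    (htest : ∀ s : State, test.eval s ≠ 0 ↔ φ (s.var 17 / s.var 13) (s.var 1))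
    (hD : (n + 1) * D < 2 ^ L) {s : State} (hR : Ready n adj X s)
    (hZ : s.var 11 = Z) (hD13 : s.var 13 = D) (hk : s.var 1 = k) :
    Tri r L (testRoots test) s (n * (rootSteps n K D + 2) + 3) fun s' =>
      (s'.var 16 = 1 ↔ ∃ root < n, ∃ j < (n + 1) * D, φ (j / D) k ∧
        total n adj root X / Z ^ j % 2 = 1) := by
  refine Tri.conseq (T := 1 + (n * (rootSteps n K D + 2) + 2)) ?_ (fun _ _ h => h) (by omega)
  refine Tri.seq (Q' := fun s' => s'.var 16 = 0)
    (Tri.assign (v := 0) rfl (by positivity) (by simp)) fun s₁ f₁ h₁ => ?_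
  have hR1 : Ready n adj X s₁ := hR.frame f₁ rfl rfl rfl
  refine Tri.forLoop (fun i s' => s'.var 16 = 1 ↔ ∃ root < i, ∃ j < (n + 1) * D,
    φ (j / D) k ∧ total n adj root X / Z ^ j % 2 = 1) rfl hl.lt ?_ ?_ ?_
  · intro s' hf
    simp [hf.var 0 rfl, hR1.n_eq]
  · simp [h₁]
  · intro i hi s' hI hxi hf
    refine (testRoot_spec hl hsymm hirr htest hD (hR1.frame hf rfl rfl rfl) hxi
      (by rw [hf.var 11 rfl, f₁.var 11 rfl, hZ]) (by rw [hf.var 13 rfl, f₁.var 13 rfl, hD13])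
      (by rw [hf.var 1 rfl, f₁.var 1 rfl, hk])).conseq (fun s'' _ h => ?_) le_rfl
    have e : (s''.setVar 7 (i + 1)).var 16 = s''.var 16 := by simp
    rw [e, h, hI]
    clear h
    constructor
    · rintro (⟨root, hr, h⟩ | h)
      exacts [⟨root, by omega, h⟩, ⟨i, by omega, h⟩]
    · rintro ⟨root, hr, h⟩
      rcases Nat.lt_succ_iff_lt_or_eq.1 hr with hr | rfl
      exacts [.inl ⟨root, hr, h⟩, .inr h]

end verification

/-! ### The preparations: adjacency matrix of the positions, base, and random weights -/

/-- Write the adjacency matrix with respect to positions into array `2`. -/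
def computeAdj : Prog :=
  tab 2 (.var 0 * .var 0) (.get 1 (.get 0 (.var 2 / .var 0) * .var 0 + .get 0 (.var 2 % .var 0)))

/-- Compute in variable `10` the number of random bits of a weight, in variable `9` two to its
power. It is at most `n`, so that a loop of length `n` finds it. -/
def computeBits : Prog :=
  .seq (.assign 9 1) <|
  .seq (.assign 10 0) <|
  forLoop 17 (.var 0) <|
  .ite (.lt (.var 9) (.var 0 + .var 0))
    (.seq (.assign 9 (.var 9 + .var 9)) (.assign 10 (.var 10 + 1))) .skip

/-- Compute the base in variable `11`. -/
def computeBase : Prog :=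
  .seq (.assign 11 1) <|
  forLoop 17 (.var 0 * (.var 0 + 2)) <|
  .assign 11 (.var 11 + .var 11)

/-- Compute the shift in variable `13` and the corresponding power of the base in variable `12`. -/
def computeShift : Prog :=
  .seq (.assign 13 (.var 0 * .var 9 + 1)) <|
  .seq (.assign 12 1) <|
  forLoop 17 (.var 13) <|
  .assign 12 (.var 12 * .var 11)

/-- Draw the weights and write the corresponding powers of the base into array `3`: a further bit
`c` of a weight `a` turns the power with exponent `a` into the one with exponent `2 * a + c`. -/
def drawWeights : Prog :=
  forLoop 17 (.var 0) <|
  .seq (.assign 14 1) <|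
  .seq (forLoop 18 (.var 10) <|
    .seq (.flip 15) (.assign 14 (.var 14 * .var 14 * (1 - .var 15 + .var 15 * .var 11)))) <|
  .store 3 (.var 17) (.var 12 * .var 14)

section verification

variable {r : ℕ → Bool} {L n : ℕ}

/-- The number of random bits of a weight. -/
def weightBits (n : ℕ) : ℕ := Nat.clog 2 (2 * n)

theorem le_two_pow_weightBits (n : ℕ) : 2 * n ≤ 2 ^ weightBits n :=
  Nat.le_pow_clog (by norm_num) _

theorem weightBits_le (n : ℕ) : weightBits n ≤ n := by
  rw [weightBits, Nat.clog_le_iff_le_pow (by norm_num)]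
  rcases n with _ | n
  · norm_num
  · have : n < 2 ^ n := Nat.lt_two_pow_self
    rw [pow_succ]; omega

theorem two_pow_weightBits_le (n : ℕ) : 2 ^ weightBits n ≤ 4 * n + 1 := by
  rcases Nat.eq_zero_or_pos n with rfl | hn
  · simp [weightBits]
  · have h1 : 0 < weightBits n := Nat.clog_pos (by norm_num) (by omega)
    have h2 := Nat.pow_pred_clog_lt_self (b := 2) (by norm_num) (x := 2 * n) (by omega)
    obtain ⟨c, hc⟩ : ∃ c, weightBits n = c + 1 := ⟨weightBits n - 1, by omega⟩
    rw [← weightBits, hc, Nat.pred_succ] at h2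
    rw [hc, pow_succ]
    omega

theorem computeBits_spec (hL : 4 * n + 1 < 2 ^ L) {s : State} (hn : s.var 0 = n) :
    Tri r L computeBits s (n * 5 + 4)
      fun s' => s'.var 10 = weightBits n ∧ s'.var 9 = 2 ^ weightBits n := by
  refine Tri.conseq (T := 1 + (1 + (n * (3 + 2) + 2))) ?_ (fun _ _ h => h) (by omega)
  refine Tri.seq (Q' := fun s' => s'.var 9 = 1)
    (Tri.assign (v := 1) rfl (by omega) (by simp)) fun s₁ f₁ h₁ => ?_
  refine Tri.seq (Q' := fun s' => s'.var 10 = 0)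
    (Tri.assign (v := 0) rfl (by positivity) (by simp)) fun s₂ f₂ h₂ => ?_
  have hn2 : s₂.var 0 = n := by rw [f₂.var 0 rfl, f₁.var 0 rfl, hn]
  have h9 : s₂.var 9 = 1 := by rw [f₂.var 9 rfl, h₁]
  refine (Tri.forLoop (m := n) (fun i s' => s'.var 10 = min i (weightBits n) ∧
    s'.var 9 = 2 ^ min i (weightBits n)) rfl (by omega) ?_ ?_ ?_).conseq
    (fun s' _ h => by rwa [min_eq_right (weightBits_le n)] at h) le_rfl
  · intro s' hf
    simp [hf.var 0 rfl, hn2]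
  · simp [h₂, h9]
  · rintro i hi s' ⟨hI1, hI2⟩ hxi hf
    have hle := two_pow_weightBits_le n
    have hble := weightBits_le n
    have hcond : (Expr.lt (.var 9) (.var 0 + .var 0)).eval s' =
        if i < weightBits n then 1 else 0 := by
      simp only [Expr.eval_lt, Expr.eval_var, Expr.eval_add, hI2, hf.var 0 rfl, hn2, ← two_mul]
      refine if_congr ?_ rfl rfl
      rw [← Nat.lt_clog_iff_pow_lt (by norm_num), ← weightBits]
      omega
    refine Tri.ite (T := 2) (fun he => ?_) (fun he => ?_)
    · have hlt : i < weightBits n := by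
        by_contra hc; exact he (by rw [hcond, if_neg hc])
      have hpow : 2 ^ (i + 1) ≤ 2 ^ weightBits n := Nat.pow_le_pow_right (by norm_num) hlt
      rw [min_eq_left hlt.le] at hI1 hI2
      rw [min_eq_left (by omega)]
      refine Tri.seq (T := 1) (T' := 1) (Q' := fun s'' => s''.var 9 = 2 ^ (i + 1))
        (Tri.assign (v := 2 ^ (i + 1)) ?_ (by omega) (by simp)) fun s'' f'' h'' => ?_
      · simp [hI2, pow_succ, mul_two]
      · refine Tri.assign (v := i + 1) ?_ (by omega) ?_
        · simp [f''.var 10 rfl, hI1]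
        · simp [h'']
    · have hge : weightBits n ≤ i := by
        by_contra hc; rw [hcond, if_pos (by omega)] at he; cases he
      rw [min_eq_right hge] at hI1 hI2
      rw [min_eq_right (by omega)]
      exact (Tri.skip (by simp [hI1, hI2])).conseq (fun _ _ h => h) (by omega)

theorem computeBase_spec (hL : base n < 2 ^ L) (hn2 : n * (n + 2) < 2 ^ L) {s : State}
    (hn : s.var 0 = n) :
    Tri r L computeBase s (n * (n + 2) * 3 + 3) fun s' => s'.var 11 = base n := by
  refine Tri.conseq (T := 1 + (n * (n + 2) * (1 + 2) + 2)) ?_ (fun _ _ h => h) (by omega)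
  have hb : 0 < base n := by unfold base; positivity
  refine Tri.seq (Q' := fun s' => s'.var 11 = 1)
    (Tri.assign (v := 1) rfl (by omega) (by simp)) fun s₁ f₁ h₁ => ?_
  refine Tri.forLoop (m := n * (n + 2)) (fun i s' => s'.var 11 = 2 ^ i) rfl hn2 ?_
    (by simp [h₁]) ?_
  · intro s' hf
    simp [hf.var 0 rfl, f₁.var 0 rfl, hn]
  · intro i hi s' hI hxi hf
    refine Tri.assign (v := 2 ^ (i + 1)) (by simp [hI, pow_succ, mul_two])
      (lt_of_le_of_lt ?_ hL) (by simp)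
    exact Nat.pow_le_pow_right (by norm_num) hi

theorem computeShift_spec {N Z : ℕ} (hL : Z ^ shift n N < 2 ^ L) (hZ0 : 0 < Z)
    (hD : shift n N < 2 ^ L) {s : State}
    (hn : s.var 0 = n) (hN : s.var 9 = N) (hZ : s.var 11 = Z) :
    Tri r L computeShift s (shift n N * 3 + 4)
      fun s' => s'.var 13 = shift n N ∧ s'.var 12 = Z ^ shift n N := by
  refine Tri.conseq (T := 1 + (1 + (shift n N * (1 + 2) + 2))) ?_ (fun _ _ h => h) (by omega)
  have hb : 0 < Z ^ shift n N := by positivity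
  refine Tri.seq (Q' := fun s' => s'.var 13 = shift n N)
    (Tri.assign (v := shift n N) (by simp [hn, hN, shift]) hD (by simp)) fun s₁ f₁ h₁ => ?_
  refine Tri.seq (Q' := fun s' => s'.var 12 = 1)
    (Tri.assign (v := 1) rfl (by omega) (by simp)) fun s₂ f₂ h₂ => ?_
  have h13 : s₂.var 13 = shift n N := by rw [f₂.var 13 rfl, h₁]
  refine (Tri.forLoop (m := shift n N) (fun i s' => s'.var 12 = Z ^ i) rfl hD ?_
    (by simp [h₂]) ?_).conseq (fun s' hf h => ⟨by rw [hf.var 13 rfl, h13], h⟩) le_rfl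
  · intro s' hf
    simp [hf.var 13 rfl, h13]
  · intro i hi s' hI hxi hf
    refine Tri.assign (v := Z ^ (i + 1)) ?_ (lt_of_le_of_lt ?_ hL) (by simp)
    · simp [hf.var 11 rfl, f₂.var 11 rfl, f₁.var 11 rfl, hZ, hI, pow_succ]
    · exact Nat.pow_le_pow_right hZ0 hi

theorem drawWeights_spec {b Z D : ℕ} (hL : Z ^ (D + 2 ^ b) < 2 ^ L) (hZ0 : 0 < Z)
    (hL0 : 0 < L) (hnL : n < 2 ^ L) (hbL : b < 2 ^ L) {s : State} (hpos : s.pos = 0)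
    (hn : s.var 0 = n) (hb : s.var 10 = b) (hZ : s.var 11 = Z) (hZD : s.var 12 = Z ^ D) :
    Tri r L drawWeights s (n * (b * 4 + 6) + 2)
      fun s' => ∀ u < n, s'.arr 3 u = Z ^ (D + bitsVal r (u * b) b) := by
  have hle : ∀ e ≤ D + 2 ^ b, Z ^ e < 2 ^ L := fun e he =>
    (Nat.pow_le_pow_right hZ0 he).trans_lt hL
  refine Tri.conseq (T := n * ((1 + ((b * (2 + 2) + 2) + 1)) + 2) + 2) ?_ (fun _ _ h => h)
    (by rw [show 1 + ((b * (2 + 2) + 2) + 1) + 2 = b * 4 + 6 by omega])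
  refine (Tri.forLoop (m := n) (fun i s' => s'.pos = i * b ∧
    ∀ u < i, s'.arr 3 u = Z ^ (D + bitsVal r (u * b) b)) rfl hnL ?_ ?_ ?_).conseq
    (fun _ _ h => h.2) le_rfl
  · intro s' hf
    simp [hf.var 0 rfl, hn]
  · simp [hpos]
  · rintro i hi s' ⟨hI1, hI2⟩ hxi hf
    refine Tri.seq (Q' := fun s'' => s''.var 14 = 1)
      (Tri.assign (v := 1) rfl (by simpa using hle 0 (Nat.zero_le _)) (by simp))
      fun s₁ f₁ h₁ => ?_
    have e10 : s₁.var 10 = b := by rw [f₁.var 10 rfl, hf.var 10 rfl, hb]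
    have e11 : s₁.var 11 = Z := by rw [f₁.var 11 rfl, hf.var 11 rfl, hZ]
    have e12 : s₁.var 12 = Z ^ D := by rw [f₁.var 12 rfl, hf.var 12 rfl, hZD]
    have ep : s₁.pos = i * b := by rw [f₁.pos rfl, hI1]
    have e17 : s₁.var 17 = i := by rw [f₁.var 17 rfl, hxi]
    refine Tri.seq (Tri.forLoop (m := b) (fun j s'' => s''.pos = i * b + j ∧
      s''.var 14 = Z ^ bitsVal r (i * b) j) rfl hbL ?_ ?_ ?_) fun s₂ f₂ h₂ => ?_
    · intro s'' hf'
      simp [hf'.var 10 rfl, e10]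
    · simp [ep, h₁, bitsVal]
    · rintro j hj s'' ⟨hJ1, hJ2⟩ hxj hf'
      refine Tri.seq (T := 1) (T' := 1) (Q' := fun s₃ => s₃.pos = i * b + (j + 1) ∧
        s₃.var 15 = if r (i * b + j) then 1 else 0)
        (Tri.flip hL0 (by simp [hJ1, add_assoc])) fun s₃ f₃ h₃ => ?_
      refine Tri.assign (v := Z ^ bitsVal r (i * b) (j + 1)) ?_ (hle _ ?_) ?_
      · simp only [Expr.eval_mul, Expr.eval_add, Expr.eval_sub, Expr.eval_var, Expr.eval_ofNat,
          h₃.2, f₃.var 14 rfl, hJ2, f₃.var 11 rfl, hf'.var 11 rfl, e11]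
        rw [bitsVal, pow_add, two_mul, pow_add]
        split_ifs <;> simp
      · have h5 := bitsVal_lt r (i * b) (j + 1)
        have h6 : 2 ^ (j + 1) ≤ 2 ^ b := Nat.pow_le_pow_right (by norm_num) hj
        exact (h5.le.trans h6).trans (Nat.le_add_left _ _)
      · simp [h₃.1]
    · have h5 := bitsVal_lt r (i * b) b
      refine Tri.store (i := i) (v := Z ^ (D + bitsVal r (i * b) b)) ?_ ?_ (hle _ (by omega)) ?_
      · simp [f₂.var 17 rfl, e17]
      · simp [f₂.var 12 rfl, e12, h₂.2, pow_add]
      · refine ⟨by simp [h₂.1, add_mul], fun u hu => ?_⟩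
        simp only [State.setVar_arr, State.setArr_arr, true_and]
        split_ifs with h
        · rw [h]
        · rw [f₂.arr 3 rfl, f₁.arr 3 rfl, hI2 u (by omega)]

end verification

/-! ### Passing from vertices to positions -/

section positions

/-- An isomorphism carries connected vertex covers to connected vertex covers. -/
theorem IsConnectedVertexCover.map {V W : Type*} {G : SimpleGraph V} {H : SimpleGraph W}
    (e : G ≃g H) {S : Finset V} (h : IsConnectedVertexCover G S) :
    IsConnectedVertexCover H (S.map e.toEquiv.toEmbedding) := by
  have hcoe : (S.map e.toEquiv.toEmbedding : Set W) = e '' S := by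
    rw [Finset.coe_map]; rfl
  refine ⟨by rw [hcoe]; exact SimpleGraph.isVertexCover_image_iso e |>.2 h.1, ?_⟩
  have hmaps : Set.MapsTo e (S : Set V) (S.map e.toEquiv.toEmbedding : Set W) := by
    rw [hcoe]; exact Set.mapsTo_image _ _
  refine h.2.map (SimpleGraph.induceHom e.toHom hmaps) ?_
  rintro ⟨w, hw⟩
  rw [hcoe] at hw
  obtain ⟨v, hv, rfl⟩ := hw
  exact ⟨⟨v, hv⟩, rfl⟩

theorem exists_cover_comap_iff {n : ℕ} (G : SimpleGraph (Fin n)) (ℓ : Fin n ≃ Fin n)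
    (p : ℕ → Prop) : (∃ S, IsConnectedVertexCover (G.comap ℓ) S ∧ p S.card) ↔
      ∃ S, IsConnectedVertexCover G S ∧ p S.card := by
  constructor
  · rintro ⟨S, h, hp⟩
    exact ⟨_, h.map (SimpleGraph.Iso.comap ℓ G), by rwa [Finset.card_map]⟩
  · rintro ⟨S, h, hp⟩
    exact ⟨_, h.map (SimpleGraph.Iso.comap ℓ G).symm, by rwa [Finset.card_map]⟩

variable {n : ℕ} (G : SimpleGraph (Fin n)) (ℓ : Fin n ≃ Fin n)

open Classical in
/-- The adjacency matrix of the graph on the positions, indexed by the codes of pairs. -/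
noncomputable def posAdj (q : ℕ) : Bool :=
  decide (∃ u v : Fin n, G.Adj (ℓ u) (ℓ v) ∧ q = u * n + v)

theorem posAdj_iff (u v : Fin n) : posAdj G ℓ (u * n + v) = true ↔ (G.comap ℓ).Adj u v := by
  simp only [posAdj, decide_eq_true_eq, SimpleGraph.comap_adj]
  constructor
  · rintro ⟨u', v', h, he⟩
    have h1 := congrArg (· / n) he
    have h2 := congrArg (· % n) he
    simp only [pair_div v.2, pair_mod v.2, pair_div v'.2, pair_mod v'.2] at h1 h2
    rwa [Fin.ext h1, Fin.ext h2]
  · exact fun h => ⟨u, v, h, rfl⟩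

theorem posAdj_symm (u : ℕ) (hu : u < n) (v : ℕ) (hv : v < n) :
    posAdj G ℓ (u * n + v) = posAdj G ℓ (v * n + u) := by
  rw [Bool.eq_iff_iff]
  exact (posAdj_iff G ℓ ⟨u, hu⟩ ⟨v, hv⟩).trans
    ((SimpleGraph.adj_comm _ _ _).trans (posAdj_iff G ℓ ⟨v, hv⟩ ⟨u, hu⟩).symm)

theorem posAdj_self (v : ℕ) (hv : v < n) : posAdj G ℓ (v * n + v) = false := by
  rw [Bool.eq_false_iff]
  exact fun h => (G.comap ℓ).irrefl ((posAdj_iff G ℓ ⟨v, hv⟩ ⟨v, hv⟩).1 h)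

/-- A list of edges across position `i` is no longer than the cutwidth. -/
theorem length_le_cutwidth (i : Fin n) (Q : List ℕ) (hQ : Q.Nodup)
    (h : ∀ q ∈ Q, q < n * n ∧ posAdj G ℓ q = true ∧ q / n ≤ i ∧ i < q % n) :
    Q.length ≤ cutwidth G ℓ := by
  have hn : 0 < n := i.pos
  refine le_trans ?_ (Finset.le_sup (f := fun i => (cut G ℓ i).ncard) (Finset.mem_univ i))
  rw [← List.toFinset_card_of_nodup hQ, ← Set.ncard_coe_finset]
  set left : ℕ → Fin n := fun q => ⟨q / n % n, Nat.mod_lt _ hn⟩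
  set right : ℕ → Fin n := fun q => ⟨q % n, Nat.mod_lt _ hn⟩
  have hleft : ∀ q ∈ Q, (left q : ℕ) = q / n := fun q hq =>
    Nat.mod_eq_of_lt (Nat.div_lt_of_lt_mul (h q hq).1)
  refine Set.ncard_le_ncard_of_injOn (fun q => s(ℓ (left q), ℓ (right q))) ?_ ?_ (Set.toFinite _)
  · intro q hq
    rw [Finset.mem_coe, List.mem_toFinset] at hq
    obtain ⟨h1, h2, h3, h4⟩ := h q hq
    refine ⟨?_, left q, right q, ?_, h4, rfl⟩
    · rw [SimpleGraph.mem_edgeSet]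
      refine (posAdj_iff G ℓ (left q) (right q)).1 ?_
      rw [hleft q hq]
      exact (Nat.div_add_mod' q n).symm ▸ h2
    · exact Fin.le_def.2 (by rw [hleft q hq]; exact h3)
  · intro q hq q' hq' he
    rw [Finset.mem_coe, List.mem_toFinset] at hq hq'
    have e1 := hleft q hq
    have e2 := hleft q' hq'
    have h1 := (h q hq).2.2
    have h2 := (h q' hq').2.2
    have key : left q = left q' ∧ right q = right q' := by
      rcases Sym2.eq_iff.1 he with h3 | h3
      · exact ⟨ℓ.injective h3.1, ℓ.injective h3.2⟩
      · have h4 : q / n = q' % n := by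
          rw [← e1]; exact congrArg Fin.val (ℓ.injective h3.1)
        omega
    have h5 : q / n = q' / n := by rw [← e1, ← e2, key.1]
    have h6 : q % n = q' % n := congrArg Fin.val key.2
    rw [← Nat.div_add_mod' q n, ← Nat.div_add_mod' q' n, h5, h6]

/-- While a vertex is processed, the wires cross the cut before it until the first wire is added,
and the cut after it from then on. -/
theorem length_wires_le (v : ℕ) (hv : v < n) (j : ℕ) :
    (wires n (posAdj G ℓ) v j).length ≤ cutwidth G ℓ := by
  have hnd : (wires n (posAdj G ℓ) v j).Nodup := List.nodup_range.filter _
  have hmem : ∀ q ∈ wires n (posAdj G ℓ) v j, q < n * n ∧ posAdj G ℓ q = true ∧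
      ((q / n < v ∧ v < q % n) ∨ (q / n < v ∧ q % n = v ∧ j ≤ q / n) ∨
    (q / n = v ∧ v < q % n ∧ q % n < j)) := by
    intro q hq
    simpa only [wires, live, List.mem_filter, List.mem_range, Bool.and_eq_true,
      decide_eq_true_eq] using hq
  rcases le_or_gt j v with hj | hj
  · rcases Nat.eq_zero_or_pos v with rfl | hv0
    · have hnil : wires n (posAdj G ℓ) 0 j = [] := by
        refine List.eq_nil_iff_forall_not_mem.2 fun q hq => ?_
        have := (hmem q hq).2.2
        have := Nat.zero_le (q / n)
        omega
      rw [hnil]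
      exact Nat.zero_le _
    · refine length_le_cutwidth G ℓ ⟨v - 1, by omega⟩ _ hnd fun q hq => ?_
      obtain ⟨h1, h2, h3⟩ := hmem q hq
      exact ⟨h1, h2, by simp only; omega, by simp only; omega⟩
  · refine length_le_cutwidth G ℓ ⟨v, hv⟩ _ hnd fun q hq => ?_
    obtain ⟨h1, h2, h3⟩ := hmem q hq
    exact ⟨h1, h2, by simp only; omega, by simp only; omega⟩

end positions

/-! ### The algorithm -/

/-- The algorithm. The test decides whether the size given by the position of a digit is
admissible. -/
def algorithm (test : Expr) : Prog :=
  .seq computeAdj <|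
  .seq computeBits <|
  .seq computeBase <|
  .seq computeShift <|
  .seq drawWeights <|
  .seq (testRoots test) <|
  .assign 0 (.var 16)

/-- The number of values of a weight. -/
def weightRange (n : ℕ) : ℕ := 2 ^ weightBits n

/-- The exponent of the largest number that can occur in array `3`. -/
def weightExp (n : ℕ) : ℕ := n * (n + 2) * (shift n (weightRange n) + weightRange n)

/-- A bound for the bit lengths of all numbers: the table entries are at most
`2 ^ (2 * n + weightExp n * n + n * n)`, the other summands account for loop bounds and the
input. -/
def bitBound (n k : ℕ) : ℕ :=
  weightExp n * (n + 1) + (n + 1) * shift n (weightRange n) + 3 * (n * n) + 7 * n + k.size + 10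

/-- A bound for the number of steps, where `K` bounds the number of colourings of the wires. -/
def stepBound (n K : ℕ) : ℕ :=
  n * n * 3 + n * 5 + n * (n + 2) * 3 + shift n (weightRange n) * 3 +
    n * (weightBits n * 4 + 6) + n * (rootSteps n K (shift n (weightRange n)) + 2) + 19

section verification

variable {r : ℕ → Bool} {n : ℕ} (G : SimpleGraph (Fin n)) (ℓ : Fin n ≃ Fin n) (k : ℕ)

theorem lt_two_pow_of_le {a L : ℕ} (h : a ≤ L) : a < 2 ^ L :=
  h.trans_lt Nat.lt_two_pow_self

theorem two_pow_weightExp (n : ℕ) :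
    base n ^ (shift n (weightRange n) + weightRange n) = 2 ^ weightExp n := by
  rw [base, ← pow_mul, weightExp]

theorem limits {w : ℕ → ℕ} (hw : ∀ u, w u < weightRange n) :
    Limits n (posAdj G ℓ) (fun u => base n ^ (shift n (weightRange n) + w u)) (2 ^ weightExp n)
      (2 ^ cutwidth G ℓ) (bitBound n k) where
  one_le := Nat.one_le_two_pow
  X_le u _ := by
    rw [← two_pow_weightExp]
    exact Nat.pow_le_pow_right (by unfold base; positivity) (by have := hw u; omega)
  sq_le := by
    unfold bitBound
    have := Nat.le_mul_self n
    omega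
  table_lt := by
    have h3 : (3 : ℕ) ^ n ≤ 2 ^ (2 * n) := by
      rw [pow_mul]; exact Nat.pow_le_pow_left (by norm_num) n
    refine (Nat.mul_le_mul_right _ h3).trans_lt ?_
    rw [← pow_mul, ← pow_add, ← pow_add]
    refine Nat.pow_lt_pow_right (by norm_num) ?_
    unfold bitBound
    rw [mul_add (weightExp n)]
    omega
  wires_le v hv j _ := Nat.pow_le_pow_right (by norm_num) (length_wires_le G ℓ v hv j)

theorem input_bounded : (input G ℓ k).Bounded (bitBound n k) := by
  have hn : n < 2 ^ bitBound n k := lt_two_pow_of_le (by unfold bitBound; omega)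
  have hk : k < 2 ^ bitBound n k := by
    rw [← Nat.size_le]; unfold bitBound; omega
  constructor
  · intro x
    simp only [input]
    split_ifs <;> omega
  · intro a i
    simp only [input]
    split_ifs with h1 h2
    · exact (ℓ ⟨i, h2⟩).2.trans hn
    · omega
    · exact lt_two_pow_of_le (by unfold bitBound; omega)
    · omega
    · omega

theorem computeAdj_spec {L : ℕ} (hL : n * n < 2 ^ L) (hL0 : 1 < 2 ^ L) :
    Tri r L computeAdj (input G ℓ k) (n * n * 3 + 2)
      fun s' => ∀ q < n * n, s'.arr 2 q = if posAdj G ℓ q then 1 else 0 := by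
  have h0 : (input G ℓ k).var 0 = n := rfl
  refine (Tri.tab (m := n * n) (fun q => if posAdj G ℓ q then 1 else 0) hL ?_ ?_ ?_).conseq
    (fun s' _ h q hq => by rw [h, if_pos hq]) le_rfl
  · intro s' hf
    simp [hf.var 0 rfl, h0]
  · intro q hq s' hf hxq
    have h1 : q / n < n := Nat.div_lt_of_lt_mul hq
    have h2 : q % n < n := Nat.mod_lt _ (Nat.pos_of_ne_zero (by rintro rfl; simp at hq))
    have hget : ∀ i (hi : i < n), (input G ℓ k).arr 0 i = ℓ ⟨i, hi⟩ := by
      intro i hi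
      simp [input, hi]
    simp only [Expr.eval_get, Expr.eval_add, Expr.eval_mul, Expr.eval_div, Expr.eval_mod,
      Expr.eval_var, hxq, hf.var 0 rfl, h0, hf.arr 0 rfl, hf.arr 1 rfl, hget _ h1, hget _ h2]
    simp only [input, one_ne_zero, if_false, if_true]
    have h3 := posAdj_iff G (Equiv.refl _) (ℓ ⟨q / n, h1⟩) (ℓ ⟨q % n, h2⟩)
    have h4 := posAdj_iff G ℓ ⟨q / n, h1⟩ ⟨q % n, h2⟩
    simp only [Nat.div_add_mod'] at h4
    simp only [posAdj, decide_eq_true_eq] at h3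
    by_cases h : posAdj G ℓ q = true
    · refine Eq.trans (if_pos ?_) (if_pos h).symm
      exact h3.2 (h4.1 h)
    · refine Eq.trans (if_neg ?_) (if_neg h).symm
      exact fun h' => h (h4.2 (h3.1 h'))
  · intro q _
    split_ifs <;> omega

/-- The final value of the answer and the number of steps. -/
theorem algorithm_spec {test : Expr} {φ : ℕ → ℕ → Prop}
    (htest : ∀ s : State, test.eval s ≠ 0 ↔ φ (s.var 17 / s.var 13) (s.var 1)) :
    Tri r (bitBound n k) (algorithm test) (input G ℓ k) (stepBound n (2 ^ cutwidth G ℓ))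
      fun s' => (s'.var 0 = 1 ↔ Detected n (posAdj G ℓ) φ (weightRange n)
        (fun u => bitsVal r (u * weightBits n) (weightBits n)) k) := by
  intro hbd
  revert hbd
  set L := bitBound n k with hL
  set N := weightRange n with hN
  set D := shift n N with hD
  set b := weightBits n with hb
  set w : ℕ → ℕ := fun u => bitsVal r (u * b) b with hw
  have hlim := limits G ℓ k (w := w) (fun u => bitsVal_lt r (u * b) b)
  rw [← hL, ← hN, ← hD] at hlim
  have hLe : weightExp n * (n + 1) + (n + 1) * D + 3 * (n * n) + 7 * n + k.size + 10 = L := rfl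
  have hE : weightExp n < L := by
    rw [mul_add (weightExp n)] at hLe; omega
  have hDL : D ≤ (n + 1) * D := Nat.le_mul_of_pos_left _ (by omega)
  have hZ0 : 0 < base n := by unfold base; positivity
  have hZe : ∀ e, e ≤ D + N → base n ^ e < 2 ^ L := fun e he =>
    ((Nat.pow_le_pow_right hZ0 he).trans (two_pow_weightExp n).le).trans_lt
      (Nat.pow_lt_pow_right (by norm_num) hE)
  have h1 : (1 : ℕ) < 2 ^ L := lt_two_pow_of_le (by omega)
  have hnn : n * (n + 2) = n * n + 2 * n := by ring
  refine Tri.conseq (T := (n * n * 3 + 2) + ((n * 5 + 4) + ((n * (n + 2) * 3 + 3) + ((D * 3 + 4) +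
    ((n * (b * 4 + 6) + 2) + ((n * (rootSteps n (2 ^ cutwidth G ℓ) D + 2) + 3) + 1))))))
    ?_ (fun _ _ h => h) (by unfold stepBound; rw [← hN, ← hD, ← hb]; omega)
  refine Tri.seq (computeAdj_spec G ℓ k hlim.sq_lt h1) fun s₁ f₁ h₁ => ?_
  have n1 : s₁.var 0 = n := f₁.var 0 rfl
  refine Tri.seq (computeBits_spec (lt_two_pow_of_le (by omega)) n1) fun s₂ f₂ h₂ => ?_
  have n2 : s₂.var 0 = n := (f₂.var 0 rfl).trans n1
  refine Tri.seq (computeBase_spec (Nat.pow_lt_pow_right (by norm_num) (by omega))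
    (lt_two_pow_of_le (by omega)) n2) fun s₃ f₃ h₃ => ?_
  have n3 : s₃.var 0 = n := (f₃.var 0 rfl).trans n2
  refine Tri.seq (computeShift_spec (N := N) (hZe D (by omega)) hZ0
    (lt_two_pow_of_le (by omega)) n3 ((f₃.var 9 rfl).trans h₂.2) h₃) fun s₄ f₄ h₄ => ?_
  have n4 : s₄.var 0 = n := (f₄.var 0 rfl).trans n3
  have Z4 : s₄.var 11 = base n := (f₄.var 11 rfl).trans h₃
  refine Tri.seq (drawWeights_spec (b := b) (Z := base n) (D := D) (hZe _ le_rfl) hZ0 (by omega)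
    hlim.lt (lt_two_pow_of_le ((weightBits_le n).trans (by omega)))
    (by rw [f₄.pos rfl, f₃.pos rfl, f₂.pos rfl, f₁.pos rfl]; rfl) n4
    (by rw [f₄.var 10 rfl, f₃.var 10 rfl, h₂.1]) Z4 h₄.2) fun s₅ f₅ h₅ => ?_
  have hR : Ready n (posAdj G ℓ) (fun u => base n ^ (D + w u)) s₅ := by
    refine ⟨(f₅.var 0 rfl).trans n4, fun q hq => ?_, h₅⟩
    rw [f₅.arr 2 rfl, f₄.arr 2 rfl, f₃.arr 2 rfl, f₂.arr 2 rfl, h₁ q hq]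
  refine Tri.seq (testRoots_spec (Z := base n) (D := D) (k := k) hlim (posAdj_symm G ℓ)
    (posAdj_self G ℓ) htest (lt_two_pow_of_le (by omega)) hR ((f₅.var 11 rfl).trans Z4)
    ((f₅.var 13 rfl).trans h₄.1)
    (by rw [f₅.var 1 rfl, f₄.var 1 rfl, f₃.var 1 rfl, f₂.var 1 rfl, f₁.var 1 rfl]; rfl))
    fun s₆ f₆ h₆ hs => ?_
  exact Tri.assign (v := s₆.var 16) rfl (hs.1 16) (by simpa [Detected] using h₆) hs

end verification

/-! ### The running time -/

section time

theorem weightRange_le (n : ℕ) : weightRange n ≤ 4 * n + 1 := two_pow_weightBits_le n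

theorem shift_le {n s : ℕ} (hs : n + 1 ≤ s) : shift n (weightRange n) ≤ 4 * s ^ 2 := by
  have h1 := Nat.mul_le_mul_left n (weightRange_le n)
  have h2 : (n + 1) ^ 2 ≤ s ^ 2 := Nat.pow_le_pow_left hs 2
  unfold shift
  nlinarith

theorem bitBound_le {n k s : ℕ} (hs : n + k.size + 1 = s) : bitBound n k + 1 ≤ 45 * s ^ 5 := by
  have hn : n + 1 ≤ s := by omega
  have hD := shift_le hn
  have hN := weightRange_le n
  have p1 : s ^ 2 = s * s := by ring
  have p0 : s ≤ s ^ 2 := Nat.le_self_pow (by norm_num) s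
  have p2 : s ^ 2 ≤ s ^ 5 := Nat.pow_le_pow_right (by omega) (by norm_num)
  have p3 : s ^ 3 ≤ s ^ 5 := Nat.pow_le_pow_right (by omega) (by norm_num)
  have hE : weightExp n ≤ 16 * s ^ 4 := by
    calc weightExp n ≤ s * (2 * s) * (8 * s ^ 2) :=
          Nat.mul_le_mul (Nat.mul_le_mul (by omega) (by omega)) (by omega)
      _ = 16 * s ^ 4 := by ring
  have h1 : weightExp n * (n + 1) ≤ 16 * s ^ 5 := by
    calc _ ≤ 16 * s ^ 4 * s := Nat.mul_le_mul hE hn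
      _ = _ := by ring
  have h2 : (n + 1) * shift n (weightRange n) ≤ 4 * s ^ 3 := by
    calc _ ≤ s * (4 * s ^ 2) := Nat.mul_le_mul hn hD
      _ = _ := by ring
  have h3 : n * n ≤ s ^ 2 := by rw [p1]; exact Nat.mul_le_mul (by omega) (by omega)
  unfold bitBound
  omega

theorem stepBound_le {n K s : ℕ} (hs : n + 1 ≤ s) (hK : 1 ≤ K) :
    stepBound n K ≤ 160 * (K * s ^ 5) := by
  have hD := shift_le hs
  have hb := weightBits_le n
  have hn : n ≤ s := by omega
  have pw : ∀ i ≤ 5, s ^ i ≤ K * s ^ 5 := fun i hi =>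
    (Nat.pow_le_pow_right (by omega) hi).trans (Nat.le_mul_of_pos_left _ hK)
  have p0 := pw 0 (by norm_num)
  have p1 := pw 1 (by norm_num)
  have p2 := pw 2 (by norm_num)
  rw [pow_zero] at p0
  rw [pow_one] at p1
  have q1 : ∀ i, 1 ≤ s ^ i := fun i => Nat.one_le_pow _ _ (by omega)
  have h1 : n * n ≤ s ^ 2 := by rw [pow_two]; exact Nat.mul_le_mul hn hn
  have h2 : n * (n + 2) ≤ 2 * s ^ 2 := by
    calc n * (n + 2) ≤ s * (2 * s) := Nat.mul_le_mul hn (by omega)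
      _ = _ := by ring
  have h3 : n * (weightBits n * 4 + 6) ≤ 10 * s ^ 2 := by
    calc n * (weightBits n * 4 + 6) ≤ s * (10 * s) := Nat.mul_le_mul hn (by omega)
      _ = _ := by ring
  have hv : vertexSteps n K ≤ 64 * (K * s ^ 3) := by
    have a1 : s ^ 2 ≤ K * s ^ 2 := Nat.le_mul_of_pos_left _ hK
    have a2 : K ≤ K * s ^ 2 := Nat.le_mul_of_pos_right _ (q1 2)
    have a3 : K ≤ K * s ^ 3 := Nat.le_mul_of_pos_right _ (q1 3)
    have a4 : n * (4 * (n * n) + 18 * K + 24) ≤ 46 * (K * s ^ 3) := by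
      calc _ ≤ s * (46 * (K * s ^ 2)) := Nat.mul_le_mul hn (by omega)
        _ = _ := by ring
    unfold vertexSteps
    omega
  have hr : rootSteps n K (shift n (weightRange n)) ≤ 93 * (K * s ^ 4) := by
    have a1 : 1 ≤ K * s ^ 3 := Nat.mul_pos hK (q1 3)
    have a2 : 1 ≤ K * s ^ 4 := Nat.mul_pos hK (q1 4)
    have a3 : n * (vertexSteps n K + 2) ≤ 66 * (K * s ^ 4) := by
      calc _ ≤ s * (66 * (K * s ^ 3)) := Nat.mul_le_mul hn (by omega)
        _ = _ := by ring
    have a4 : (n + 1) * shift n (weightRange n) ≤ 4 * (K * s ^ 4) := by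
      calc _ ≤ s * (4 * s ^ 2) := Nat.mul_le_mul hs hD
        _ = 4 * (1 * s ^ 3) := by ring
        _ ≤ 4 * (K * s ^ 4) := Nat.mul_le_mul_left _
          (Nat.mul_le_mul hK (Nat.pow_le_pow_right (by omega) (by norm_num)))
    unfold rootSteps
    omega
  have h4 : n * (rootSteps n K (shift n (weightRange n)) + 2) ≤ 95 * (K * s ^ 5) := by
    have a2 : 1 ≤ K * s ^ 4 := Nat.mul_pos hK (q1 4)
    calc _ ≤ s * (95 * (K * s ^ 4)) := Nat.mul_le_mul hn (by omega)
      _ = _ := by ring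
  unfold stepBound
  omega

end time

/-! ### Correctness and running time of the algorithm -/

section correctness

variable {test : Expr} {φ : ℕ → ℕ → Prop}

theorem algorithm_runsInTime
    (htest : ∀ s : State, test.eval s ≠ 0 ↔ φ (s.var 17 / s.var 13) (s.var 1)) :
    RunsInTimeTwoPowCutwidth (algorithm test) := by
  refine ⟨160 * (algorithm test).weight * 45, 10, fun n G ℓ k r => ?_⟩
  obtain ⟨s', t, h1, h2, -, -⟩ := algorithm_spec G ℓ k htest (r := r) (input_bounded G ℓ k)
  refine ⟨s', t, h1, h2.trans ?_⟩
  have h3 := stepBound_le (n := n) (s := n + k.size + 1) (by omega)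
    (Nat.one_le_two_pow (n := cutwidth G ℓ))
  have h4 := bitBound_le (n := n) (k := k) rfl
  calc _ ≤ 160 * (2 ^ cutwidth G ℓ * (n + k.size + 1) ^ 5) *
        ((algorithm test).weight * (45 * (n + k.size + 1) ^ 5)) :=
        Nat.mul_le_mul h3 (Nat.mul_le_mul_left _ h4)
    _ = _ := by ring

theorem algorithm_accepts_iff
    (htest : ∀ s : State, test.eval s ≠ 0 ↔ φ (s.var 17 / s.var 13) (s.var 1))
    {n : ℕ} (G : SimpleGraph (Fin n)) (ℓ : Fin n ≃ Fin n) (k : ℕ)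
    (r : ℕ → Bool) : Accepts (algorithm test) G ℓ k r ↔
      Detected n (posAdj G ℓ) φ (weightRange n)
        (fun u => bitsVal r (u * weightBits n) (weightBits n)) k := by
  obtain ⟨s', t, h1, -, -, h4⟩ := algorithm_spec G ℓ k htest (r := r) (input_bounded G ℓ k)
  rw [← h4]
  constructor
  · rintro ⟨s'', t', h, ha⟩
    rwa [← (h1.deterministic h).1] at ha
  · exact fun ha => ⟨s', t, h1, ha⟩

theorem algorithm_solves
    (htest : ∀ s : State, test.eval s ≠ 0 ↔ φ (s.var 17 / s.var 13) (s.var 1)) :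
    SolvesOneSided (algorithm test) fun G k => ∃ S, IsConnectedVertexCover G S ∧ φ S.card k := by
  intro n G ℓ k
  have hw : ∀ r : ℕ → Bool, ∀ u < n, bitsVal r (u * weightBits n) (weightBits n) <
    weightRange n := fun r u _ => bitsVal_lt _ _ _
  simp only [← exists_cover_comap_iff G ℓ fun m => φ m k]
  constructor
  · intro hno r hacc
    rw [algorithm_accepts_iff htest] at hacc
    exact hno (hacc.exists_cover (posAdj_iff G ℓ) (hw r))
  · rintro ⟨S, hS, hφ⟩
    obtain ⟨⟨root, hroot⟩⟩ := hS.2.nonempty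
    classical
    have hF : (coversAt (G.comap ℓ) root S.card).Nonempty :=
      ⟨S, by rw [coversAt, Finset.mem_filter]; exact ⟨Finset.mem_univ _, ⟨hS, hroot⟩, rfl⟩⟩
    refine (measure_mono fun r hr => ?_).trans
      (coins_weightGen_eq_zero hF (weightBits n) (le_two_pow_weightBits n))
    by_contra hne
    refine hr ((algorithm_accepts_iff htest G ℓ k r).2 ?_)
    exact detected_of_weightGen_ne_zero (posAdj_iff G ℓ) (hw r) hφ root hne

/-- The test that the size is `k`, held in variable `1`: the position of a digit, divided by the
shift, is the size of the covers that it counts. -/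
def sizeEq : Expr := .eq (.var 17 / .var 13) (.var 1)

/-- The test that the size is at most `k`. -/
def sizeLe : Expr := 1 - .lt (.var 1) (.var 17 / .var 13)

theorem eval_sizeEq_ne_zero (s : State) :
    sizeEq.eval s ≠ 0 ↔ s.var 17 / s.var 13 = s.var 1 := by
  rw [sizeEq, Expr.eval_eq]
  split_ifs with h <;> simpa using h

theorem eval_sizeLe_ne_zero (s : State) :
    sizeLe.eval s ≠ 0 ↔ s.var 17 / s.var 13 ≤ s.var 1 := by
  rw [sizeLe, Expr.eval_sub, Expr.eval_lt, Expr.eval_ofNat]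
  split_ifs with h <;> simpa using h

end correctness

end CutwidthCVC


theorem mainTheorem2 :
    (∃ P : CutwidthCVC.Prog,
      CutwidthCVC.RunsInTimeTwoPowCutwidth P ∧
      CutwidthCVC.SolvesOneSided P (fun G k => CutwidthCVC.HasCVCOfSize G k)) ∧
    (∃ P : CutwidthCVC.Prog,
      CutwidthCVC.RunsInTimeTwoPowCutwidth P ∧
      CutwidthCVC.SolvesOneSided P (fun G k => CutwidthCVC.HasCVCOfSizeAtMost G k)) :=
  ⟨⟨_, CutwidthCVC.algorithm_runsInTime (φ := fun m k => m = k) CutwidthCVC.eval_sizeEq_ne_zero,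
      CutwidthCVC.algorithm_solves (φ := fun m k => m = k) CutwidthCVC.eval_sizeEq_ne_zero⟩,
    ⟨_, CutwidthCVC.algorithm_runsInTime (φ := fun m k => m ≤ k) CutwidthCVC.eval_sizeLe_ne_zero,
      CutwidthCVC.algorithm_solves (φ := fun m k => m ≤ k) CutwidthCVC.eval_sizeLe_ne_zero⟩⟩
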